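/- **Generalised Lidskiĭ–Višik–Ljusternik theorem.** *Setting.* Let $\mathbb{R}_{\min}=(\mathbb{R}\cup\{+\infty\},\min,+)$. Let $\mathcal C$ be the set of germs at $0^+$ of continuous functions $f:(0,\epsilon_0)\to\mathbb{C}$ with $|f(\epsilon)|\le \epsilon^{-k}$ on $(0,\epsilon_0)$ for some $k>0$. Let $\mathcal{A}=(\mathcal{A}_\epsilon)$ be an $n\times n$ matrix with entries in $\mathcal C$ such that $(\mathcal{A}_\epsilon)_{ij}=a_{ij}\epsilon^{A_{ij}}+o(\epsilon^{A_{ij}})$ as $\epsilon\to0^+$, where $a\in\mathbb{C}^{n\times n}$ and $A\in\mathbb{R}_{\min}^{n\times n}$ (if $A_{ij}=+\infty$ this means that $(\mathcal{A}_\epsilon)_{ij}=0$ for small $\epsilon$). Assume that $A$ is irreducible: in the digraph with an arc $(i,j)$ whenever $A_{ij}\neq+\infty$, any two nodes are joined by a path of positive length. *Min-plus notions.* For a square matrix $B$ over $\mathbb{R}_{\min}$, $\rho_{\min}(B)$ is the minimum over the circuits of the digraph of $B$ of the circuit's weight divided by its length. The circuits attaining it are critical, and their nodes and arcs form the critical graph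 $G^c(B)$. If $B$ is indexed by $L$, $C\subset L$, $N=L\setminus C$, and $\lambda\in\mathbb{R}$ satisfies $\lambda\le\rho_{\min}(B_{CC})$, put $\mathrm{Schur}(C,\lambda,B)=B_{NN}\oplus B_{NC}(\lambda^{-1}B_{CC})^*\lambda^{-1}B_{CN}$ (min-plus operations, $X^*=\bigoplus_{m\ge0}X^m$). Put $A_1=A$, $N^1=\{1,\dots,n\}$ and, as long as $N^\ell\ne\emptyset$, let $\alpha_\ell=\rho_{\min}(A_\ell)$, let $C_\ell$ be the set of critical nodes of $A_\ell$, $A_{\ell+1}=\mathrm{Schur}(C_\ell,\alpha_\ell,A_\ell)$ and $N^{\ell+1}=N^\ell\setminus C_\ell$. Let $k$ be the last index with $N^k\neq\emptyset$, so that $C_1,\dots,C_k$ partition $\{1,\dots,n\}$, and let $C^{\ell}=C_1\cup\dots\cup C_\ell$, $C^0=\emptyset$. Let $\hat A_{ij}=A_{ij}-\alpha_m$ for $i\in C_m$. For a min-plus eigenvector $V$ of $\hat A$ (a vector $V\not\equiv+\infty$ with $\hat AV=\lambda V$ for some $\lambda\in\mathbb{R}_{\min}$), $\mathrm{Sat}(\hat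 A,V)$ is the digraph with an arc $(i,j)$ whenever $\min_p(\hat A_{ip}+V_p)=\hat A_{ij}+V_j$. *Schur complements.* Let $G$ be either $G^c(\hat A)$ or $\mathrm{Sat}(\hat A,V)$ for some eigenvector $V$ of $\hat A$. Let $a^G$ be obtained from $a$ by replacing by $0$ the entries that are not on arcs of $G$. For $1\le\ell\le k$ let $r^\ell=a^G_{C^{\ell-1}C^{\ell-1}}$ (the empty matrix $r^1$ is invertible) and, when $r^\ell$ is invertible, $$s^\ell=a^G_{N^\ell N^\ell}-a^G_{N^\ell C^{\ell-1}}(r^\ell)^{-1}a^G_{C^{\ell-1}N^\ell},\qquad t^\ell=s^\ell_{C_\ell C_\ell}.$$ *Theorem.* Eigenvalues are repeated with multiplicities. (a) The choices of $G$ are equivalent: whether $r^\ell$ is invertible, and when it is the multiset of non-zero eigenvalues of $t^\ell$, do not depend on the choice of $G$. (b) If $r^\ell$ is invertible for some $1\le\ell\le k$, and $\lambda^\ell_1,\dots,\lambda^\ell_{m_\ell}$ are the non-zero eigenvalues of $t^\ell$, then the eigenvalues of $\mathcal{A}_\epsilon$ for small $\epsilon>0$ can be written as $n$ functions of class $\mathcal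 C$ that are grouped in 1. $m_\ell$ eigenvalues $\mathcal{L}^{\ell,j}_\epsilon\sim\lambda^\ell_j\epsilon^{\alpha_\ell}$, $1\le j\le m_\ell$; 2. $|C^{\ell-1}|$ eigenvalues $\mathcal L_\epsilon$ of order $\omega(\epsilon^{\alpha_\ell})$, i.e. $|\mathcal L_\epsilon\,\epsilon^{-\alpha_\ell}|\to+\infty$; 3. $|N^\ell|-m_\ell$ eigenvalues of order $o(\epsilon^{\alpha_\ell})$. (c) If $t^1,\dots,t^k$ are all invertible (all of them are then well defined), the eigenvalues of $\mathcal{A}_\epsilon$ for small $\epsilon>0$ can be written as $n$ functions of class $\mathcal C$ such that, for every $1\le\ell\le k$, exactly $|C_\ell|$ of them are of exact order $\epsilon^{\alpha_\ell}$ (that is, $\Theta(\epsilon^{\alpha_\ell})$), and these are $\sim\lambda^\ell_j\epsilon^{\alpha_\ell}$, where $\lambda^\ell_j$, $1\le j\le|C_\ell|$, are the eigenvalues of $t^\ell$. -/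

import Mathlib

open Filter Topology Asymptotics

noncomputable section

namespace MinPlus

/-! ### Min-plus matrices

The min-plus semiring is `WithTop ℝ`: its addition is `min` (so a sum over a finite set is
`Finset.inf`), its multiplication is `+`, its zero is `⊤` and its unit is `0`. Matrices with
abstract index sets `L ⊆ {0, …, n-1}` are given by a finset `L` and a function of two indices, of
which only the values on `L × L` matter. -/

variable {n : ℕ}

/-- The digraph of `A` has an arc `(i, j)` iff `A i j ≠ ⊤`. `A` is irreducible if any two nodes
are joined by a path (of positive length). -/
def Irreducible (A : Matrix (Fin n) (Fin n) (WithTop ℝ)) : Prop :=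
  ∀ i j, Relation.TransGen (fun p q => A p q ≠ ⊤) i j

/-- The weight of the closed sequence `c 0, c 1, …, c (k-1), c 0`. -/
def circuitWeight (A : Matrix (Fin n) (Fin n) (WithTop ℝ)) {k : ℕ} (c : Fin k → Fin n) :
    WithTop ℝ :=
  ∑ m, A (c m) (c (finRotate k m))

/-- The mean weight (weight divided by length) of a closed sequence. -/
def circuitMean (A : Matrix (Fin n) (Fin n) (WithTop ℝ)) {k : ℕ} (c : Fin k → Fin n) :
    WithTop ℝ :=
  (circuitWeight A c).map (fun w => w / (k : ℝ))

/-- The min-plus eigenvalue (minimal circuit mean) of the `L × L` matrix `A`: the minimum of the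
means of the closed sequences in `L` of length between `1` and the cardinality of `L`. -/
def rhoMin (L : Finset (Fin n)) (A : Matrix (Fin n) (Fin n) (WithTop ℝ)) : WithTop ℝ :=
  (Finset.Icc 1 L.card).inf fun k =>
    (Fintype.piFinset fun _ : Fin k => L).inf fun c => circuitMean A c

/-- `c` is a critical circuit of the `L × L` matrix `A`: a circuit of the digraph of `A`
(not necessarily elementary) that attains the minimal circuit mean. -/
def IsCriticalCircuit (L : Finset (Fin n)) (A : Matrix (Fin n) (Fin n) (WithTop ℝ)) {k : ℕ}
    (c : Fin k → Fin n) : Prop :=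
  0 < k ∧ (∀ m, c m ∈ L) ∧ (∀ m, A (c m) (c (finRotate k m)) ≠ ⊤) ∧ circuitMean A c = rhoMin L A

/-- The arcs of the critical graph of the `L × L` matrix `A`: the arcs of critical circuits. -/
def criticalGraph (L : Finset (Fin n)) (A : Matrix (Fin n) (Fin n) (WithTop ℝ))
    (i j : Fin n) : Prop :=
  ∃ (k : ℕ) (c : Fin k → Fin n), IsCriticalCircuit L A c ∧ ∃ m, c m = i ∧ c (finRotate k m) = j

open Classical in
/-- The critical nodes of the `L × L` matrix `A`: the nodes of critical circuits. -/
def criticalNodes (L : Finset (Fin n)) (A : Matrix (Fin n) (Fin n) (WithTop ℝ)) :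
    Finset (Fin n) :=
  L.filter fun i => ∃ (k : ℕ) (c : Fin k → Fin n), IsCriticalCircuit L A c ∧ ∃ m, c m = i

/-- Min-plus powers of the `C × C` matrix `B`. -/
def mpow (C : Finset (Fin n)) (B : Matrix (Fin n) (Fin n) (WithTop ℝ)) :
    ℕ → Matrix (Fin n) (Fin n) (WithTop ℝ)
  | 0 => fun i j => if i = j then 0 else ⊤
  | m + 1 => fun i j => C.inf fun p => mpow C B m i p + B p j

/-- Kleene star of the `C × C` matrix `B`. It is only used when the minimal circuit mean of `B` is
nonnegative; then the powers are bounded below and the infimum in `WithTop ℝ` is the true one. -/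
def kleeneStar (C : Finset (Fin n)) (B : Matrix (Fin n) (Fin n) (WithTop ℝ)) :
    Matrix (Fin n) (Fin n) (WithTop ℝ) :=
  fun i j => ⨅ m : ℕ, mpow C B m i j

/-- The min-plus `lam`-Schur complement of `C` in an `L × L` matrix `A` (an `L \ C`-matrix). -/
def mpSchur (C : Finset (Fin n)) (lam : ℝ) (A : Matrix (Fin n) (Fin n) (WithTop ℝ)) :
    Matrix (Fin n) (Fin n) (WithTop ℝ) :=
  fun i j => A i j ⊓ C.inf fun p => C.inf fun q =>
    A i p + kleeneStar C (fun u v => ((-lam : ℝ) : WithTop ℝ) + A u v) p q +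
      ((-lam : ℝ) : WithTop ℝ) + A q j

/-! ### Critical values

All sequences below are numbered from `0`: index `ℓ` here corresponds to `ℓ + 1` in the
traditional numbering `α₁ < ⋯ < α_k`. -/

/-- The pairs (index set `N`, matrix on `N × N`) obtained by repeatedly taking the min-plus Schur
complement of the set of critical nodes with respect to the minimal circuit mean (which is finite
when the matrix is irreducible and `N` is nonempty). -/
def stage (A : Matrix (Fin n) (Fin n) (WithTop ℝ)) :
    ℕ → Finset (Fin n) × Matrix (Fin n) (Fin n) (WithTop ℝ)
  | 0 => (Finset.univ, A)
  | ℓ + 1 =>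
    let L := (stage A ℓ).1
    let B := (stage A ℓ).2
    (L \ criticalNodes L B, mpSchur (criticalNodes L B) ((rhoMin L B).untopD 0) B)

/-- The set `N` of nodes remaining at stage `ℓ`. -/
def nodesFrom (A : Matrix (Fin n) (Fin n) (WithTop ℝ)) (ℓ : ℕ) : Finset (Fin n) := (stage A ℓ).1

/-- The critical value `α` of stage `ℓ`. -/
def alpha (A : Matrix (Fin n) (Fin n) (WithTop ℝ)) (ℓ : ℕ) : ℝ :=
  (rhoMin (stage A ℓ).1 (stage A ℓ).2).untopD 0

/-- The set of critical nodes of stage `ℓ`. -/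
def critClass (A : Matrix (Fin n) (Fin n) (WithTop ℝ)) (ℓ : ℕ) : Finset (Fin n) :=
  criticalNodes (stage A ℓ).1 (stage A ℓ).2

/-- The union of the critical classes of the stages before `ℓ`. -/
def nodesBefore (A : Matrix (Fin n) (Fin n) (WithTop ℝ)) (ℓ : ℕ) : Finset (Fin n) :=
  (Finset.range ℓ).biUnion (critClass A)

/-- The number of critical values: the first stage at which no node remains. -/
def numCrit (A : Matrix (Fin n) (Fin n) (WithTop ℝ)) : ℕ := sInf {ℓ | nodesFrom A ℓ = ∅}

/-- The diagonal of the matrix `D` of stage `ℓ`: it equals `alpha A m` at the nodes of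
`critClass A m`, for `m < ℓ`, and `alpha A ℓ` at the nodes of `nodesFrom A ℓ`. -/
def dDiag (A : Matrix (Fin n) (Fin n) (WithTop ℝ)) : ℕ → Fin n → ℝ
  | 0 => fun _ => alpha A 0
  | ℓ + 1 => fun j => if j ∈ nodesFrom A (ℓ + 1) then alpha A (ℓ + 1) else dDiag A ℓ j

/-- The matrix `Â = D⁻¹ A`, with `D` taken at the last stage. -/
def hat (A : Matrix (Fin n) (Fin n) (WithTop ℝ)) : Matrix (Fin n) (Fin n) (WithTop ℝ) :=
  fun i j => ((-dDiag A (numCrit A - 1) i : ℝ) : WithTop ℝ) + A i j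

/-- `V` is a min-plus eigenvector of `A`. -/
def IsEigenvector (A : Matrix (Fin n) (Fin n) (WithTop ℝ)) (V : Fin n → WithTop ℝ) : Prop :=
  (V ≠ fun _ => ⊤) ∧
    ∃ lam : WithTop ℝ, ∀ i, (Finset.univ.inf fun j => A i j + V j) = lam + V i

/-- The arcs of the saturation graph of `A` and `V`. -/
def satGraph (A : Matrix (Fin n) (Fin n) (WithTop ℝ)) (V : Fin n → WithTop ℝ)
    (i j : Fin n) : Prop :=
  (Finset.univ.inf fun p => A i p + V p) = A i j + V j

/-! ### Conventional Schur complements -/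

open Classical in
/-- The matrix `b^G`: the entries of `b` that are not on arcs of `G` are replaced by zero. -/
def restrictGraph (b : Matrix (Fin n) (Fin n) ℂ) (G : Fin n → Fin n → Prop) :
    Matrix (Fin n) (Fin n) ℂ :=
  fun i j => if G i j then b i j else 0

/-- The block of `b` with rows in `J` and columns in `K`. -/
def block (J K : Finset (Fin n)) (b : Matrix (Fin n) (Fin n) ℂ) : Matrix J K ℂ :=
  b.submatrix Subtype.val Subtype.val

/-- The Schur complement `b_NN - b_NC (b_CC)⁻¹ b_CN` of `C` in the `(C ∪ N) × (C ∪ N)` matrix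
`b`; it is well defined when `b_CC` is invertible. -/
def schur (C N : Finset (Fin n)) (b : Matrix (Fin n) (Fin n) ℂ) : Matrix N N ℂ :=
  block N N b - block N C b * (block C C b)⁻¹ * block C N b

/-- The matrix `r` of stage `ℓ`. -/
def rMat (A : Matrix (Fin n) (Fin n) (WithTop ℝ)) (a : Matrix (Fin n) (Fin n) ℂ)
    (G : Fin n → Fin n → Prop) (ℓ : ℕ) : Matrix (nodesBefore A ℓ) (nodesBefore A ℓ) ℂ :=
  block (nodesBefore A ℓ) (nodesBefore A ℓ) (restrictGraph a G)

/-- The matrix `s` of stage `ℓ`. -/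
def sMat (A : Matrix (Fin n) (Fin n) (WithTop ℝ)) (a : Matrix (Fin n) (Fin n) ℂ)
    (G : Fin n → Fin n → Prop) (ℓ : ℕ) : Matrix (nodesFrom A ℓ) (nodesFrom A ℓ) ℂ :=
  schur (nodesBefore A ℓ) (nodesFrom A ℓ) (restrictGraph a G)

theorem critClass_subset (A : Matrix (Fin n) (Fin n) (WithTop ℝ)) (ℓ : ℕ) :
    critClass A ℓ ⊆ nodesFrom A ℓ :=
  fun i hi => by
    classical
    simp only [critClass, criticalNodes, Finset.mem_filter] at hi
    exact hi.1

/-- The matrix `t` of stage `ℓ`: the block of `s` indexed by the critical class. -/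
def tMat (A : Matrix (Fin n) (Fin n) (WithTop ℝ)) (a : Matrix (Fin n) (Fin n) ℂ)
    (G : Fin n → Fin n → Prop) (ℓ : ℕ) : Matrix (critClass A ℓ) (critClass A ℓ) ℂ :=
  (sMat A a G ℓ).submatrix (fun i => ⟨i.1, critClass_subset A ℓ i.2⟩)
    (fun i => ⟨i.1, critClass_subset A ℓ i.2⟩)

/-- The multiset of the nonzero eigenvalues (with multiplicities) of a complex matrix. -/
def nonzeroEigenvalues {ι : Type} [Fintype ι] [DecidableEq ι] (t : Matrix ι ι ℂ) : Multiset ℂ :=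
  t.charpoly.roots.filter (· ≠ 0)

/-! ### Germs and asymptotics at `0⁺` -/

/-- `f` represents a germ at `0⁺` of a continuous function with `|f ε| ≤ ε ^ (-k)` near `0`. -/
def ClassC (f : ℝ → ℂ) : Prop :=
  ∃ ε₀ > 0, ContinuousOn f (Set.Ioo 0 ε₀) ∧
    ∃ k : ℝ, 0 < k ∧ ∀ ε ∈ Set.Ioo 0 ε₀, ‖f ε‖ ≤ ε ^ (-k)

/-- `f ε = a ε ^ e + o(ε ^ e)` as `ε → 0⁺`; for `e = ⊤` this means that `f` vanishes near `0`. -/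
def HasLeading (f : ℝ → ℂ) (a : ℂ) (e : WithTop ℝ) : Prop :=
  match e with
  | none => ∀ᶠ ε in 𝓝[>] (0 : ℝ), f ε = 0
  | some x => (fun ε => f ε - a * ((ε ^ x : ℝ) : ℂ)) =o[𝓝[>] (0 : ℝ)] fun ε => ε ^ x

/-- `f ε ~ a ε ^ x` as `ε → 0⁺`. -/
def Equiv0 (f : ℝ → ℂ) (a : ℂ) (x : ℝ) : Prop :=
  f ~[𝓝[>] (0 : ℝ)] fun ε => a * ((ε ^ x : ℝ) : ℂ)

/-- `f` is of order `ω(ε ^ x)` as `ε → 0⁺`. -/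
def OrderOmega (f : ℝ → ℂ) (x : ℝ) : Prop :=
  Tendsto (fun ε => ‖f ε * ((ε ^ (-x) : ℝ) : ℂ)‖) (𝓝[>] (0 : ℝ)) atTop

/-- `ev 0, …, ev (n-1)` are germs of class `ClassC` which, for all small `ε > 0`, are the
eigenvalues of `𝒜 ε`, counted with multiplicities. -/
def IsEigenvalueFamily (𝒜 : ℝ → Matrix (Fin n) (Fin n) ℂ) (ev : Fin n → ℝ → ℂ) : Prop :=
  (∀ i, ClassC (ev i)) ∧
    ∀ᶠ ε in 𝓝[>] (0 : ℝ), (𝒜 ε).charpoly.roots = Finset.univ.val.map fun i => ev i ε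

end MinPlus

end

open MinPlus

namespace MinPlus

open Relation

variable {n : ℕ}

/-! ### Continuous selection of roots along a real parameter -/

/-! The proof rescales the characteristic polynomial of `𝒜 ε` at each critical value and reads off
the limits of its roots. Let `d = lastDiag A` be the diagonal equal to `alpha A m` on `critClass A
m`, and let `U` be a real potential of `Â`, that is `U i + d i ≤ A i j + U j`. For `α = alpha A ℓ`,
multiply row `i` of `ε ^ α x - 𝒜 ε` by `ε ^ (-U i - min (d i) α)` and column `j` by `ε ^ U j`. All
exponents become nonnegative. In the limit the diagonal term is `0` on the earlier classes and `x`
elsewhere, the rows of the later classes lose their entries of `a`, and in the other rows only the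
entries on tight arcs of `U` survive. The limit matrix is block triangular, and the Schur complement
formula gives its determinant as `det(-r) * charpoly(t)(x) * x ^ |N|`, where `N` is the set of later
nodes. So the rescaled eigenvalues converge to the roots of this polynomial or to infinity
(`exists_tendsto_rescaled_charpoly`, `exists_limits_of_roots`).

The potential comes from backward induction over the stages, extending a subeigenvector of a
min-plus Schur complement by a Kleene star (`IsSubeigenvector.extend`). The critical values increase
strictly, because a circuit of the Schur complement with unchanged mean would expand to a critical
circuit through eliminated nodes only (`lt_rhoMin_mpSchur`). The graph does not matter: a saturation
graph is the tight graph of a potential, the critical graph consists of the tight arcs that lie on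
tight circuits, and the Leibniz expansion sees only circuits (`blockDet_restrictGraph_eq`).

Finally the eigenvalues must be continuous functions of `ε`. Greedy matching on finer and finer
grids provides them (`exists_continuous_selection`), and continuity then forces each of them to have
a single limit (`exists_tendsto_of_finite_limits`). -/

theorem exists_perm_of_map_eq {ι α : Type*} [Fintype ι] {x y : ι → α}
    (h : Finset.univ.val.map x = Finset.univ.val.map y) : ∃ σ : Equiv.Perm ι, y ∘ σ = x := by
  classical
  have key : ∀ c, Nonempty ({i // x i = c} ≃ {i // y i = c}) := by
    intro c
    have hc := congrArg (Multiset.count c) h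
    rw [Multiset.count_map, Multiset.count_map] at hc
    apply Fintype.card_eq.1
    rw [Fintype.card_subtype, Fintype.card_subtype]
    simpa [Finset.card_def, Finset.filter_val, eq_comm] using hc
  refine ⟨Equiv.ofFiberEquiv fun c => (key c).some, funext fun i => ?_⟩
  exact Equiv.ofFiberEquiv_map _ i

theorem roots_prod_X_sub_C_family {ι : Type*} (s : Finset ι) (x : ι → ℂ) :
    (∏ i ∈ s, (Polynomial.X - Polynomial.C (x i))).roots = s.val.map x := by
  rw [← Polynomial.roots_multiset_prod_X_sub_C (s.val.map x), Multiset.map_map]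
  rfl

theorem map_eq_of_prod_sub_eq {ι κ : Type*} {s : Finset ι} {t : Finset κ}
    {x : ι → ℂ} {y : κ → ℂ} (h : ∀ z, ∏ i ∈ s, (z - x i) = ∏ i ∈ t, (z - y i)) :
    s.val.map x = t.val.map y := by
  have hp : (∏ i ∈ s, (Polynomial.X - Polynomial.C (x i))) =
      ∏ i ∈ t, (Polynomial.X - Polynomial.C (y i)) := by
    apply Polynomial.funext
    intro z
    simpa [Polynomial.eval_prod] using h z
  rw [← roots_prod_X_sub_C_family s x, hp, roots_prod_X_sub_C_family]

section Selection

variable {m : ℕ} {r : ℝ → Fin m → ℂ}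

/-- By compactness, `r` has a limit along any ultrafilter converging to `s`. The limit has the same
monic polynomial as `r s`, hence is a permutation of it. -/
theorem eventually_exists_perm_near {s : ℝ} (hb : ∃ R, ∀ᶠ t in 𝓝 s, ∀ i, ‖r t i‖ ≤ R)
    (hc : ∀ z, ContinuousAt (fun t => ∏ i, (z - r t i)) s) {η : ℝ} (hη : 0 < η) :
    ∀ᶠ t in 𝓝 s, ∃ σ : Equiv.Perm (Fin m), ∀ i, ‖r t (σ i) - r s i‖ < η := by
  by_contra hcon
  rw [not_eventually, frequently_iff_neBot] at hcon
  obtain ⟨F, hF⟩ := Ultrafilter.exists_le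
    (𝓝 s ⊓ 𝓟 {t | ¬ ∃ σ : Equiv.Perm (Fin m), ∀ i, ‖r t (σ i) - r s i‖ < η})
  have hFs : (F : Filter ℝ) ≤ 𝓝 s := hF.trans inf_le_left
  have hFn : ∀ᶠ t in (F : Filter ℝ), ¬ ∃ σ : Equiv.Perm (Fin m), ∀ i, ‖r t (σ i) - r s i‖ < η :=
    (hF.trans inf_le_right) (mem_principal_self _)
  obtain ⟨R, hR⟩ := hb
  obtain ⟨y, -, hy⟩ := (isCompact_univ_pi fun _ : Fin m =>
    isCompact_closedBall (0 : ℂ) R).ultrafilter_le_nhds' (F.map r) (by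
      rw [Ultrafilter.mem_map]
      filter_upwards [hFs hR] with t ht i _
      simpa using ht i)
  have hy' : Tendsto r F (𝓝 y) := hy
  have hyi : ∀ i, Tendsto (fun t => r t i) F (𝓝 (y i)) := fun i => (tendsto_pi_nhds.1 hy') i
  obtain ⟨σ, hσ⟩ := exists_perm_of_map_eq (map_eq_of_prod_sub_eq
    (s := Finset.univ) (t := Finset.univ) (x := r s) (y := y) fun z =>
      tendsto_nhds_unique ((hc z).mono_left hFs)
        (tendsto_finsetProd _ fun i _ => (tendsto_const_nhds).sub (hyi i)))
  have hev : ∀ᶠ t in (F : Filter ℝ), ∀ j, ‖r t j - y j‖ < η :=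
    eventually_all.2 fun j => by
      simpa [dist_eq_norm] using (Metric.tendsto_nhds.1 (hyi j)) η hη
  obtain ⟨t, h1, h2⟩ := (hFn.and hev).exists
  exact h1 ⟨σ, fun i => by rw [← hσ]; exact h2 (σ i)⟩

/-- Greedy matching: each term is ordered so as to be as close as possible to the previous one in
the sup distance. -/
theorem exists_matched_chain (r : ℕ → Fin m → ℂ) :
    ∃ c : ℕ → Fin m → ℂ, (∀ k, ∃ σ : Equiv.Perm (Fin m), c k = r k ∘ σ) ∧
      ∀ k, ∀ σ : Equiv.Perm (Fin m), dist (c k) (c (k + 1)) ≤ dist (c k) (r (k + 1) ∘ σ) := by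
  have h : ∀ (u : Fin m → ℂ) (k : ℕ), ∃ σ : Equiv.Perm (Fin m),
      ∀ τ : Equiv.Perm (Fin m), dist u (r k ∘ σ) ≤ dist u (r k ∘ τ) := fun u k =>
    Finite.exists_min fun τ : Equiv.Perm (Fin m) => dist u (r k ∘ τ)
  choose best hbest using h
  refine ⟨fun k => Nat.rec (r 0) (fun k u => r (k + 1) ∘ best u (k + 1)) k, ?_, ?_⟩
  · rintro (_ | k)
    · exact ⟨1, rfl⟩
    · exact ⟨_, rfl⟩
  · intro k σ
    exact hbest _ _ _

/-- Near `s` the roots stay within `η` of the values of `r s`, and distinct values are at least `4 *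
η` apart. A greedy step moves each root by at most `2 * η`, so no root can change cluster. The bound
is independent of the mesh `1 / N`. -/
theorem chain_close {s η δ : ℝ} {N : ℕ} {c : ℕ → Fin m → ℂ}
    (hη : ∀ i j, ‖r s i - r s j‖ < 4 * η → r s i = r s j)
    (hδ : ∀ t, |t - s| < δ → ∃ σ : Equiv.Perm (Fin m), ∀ i, ‖r t (σ i) - r s i‖ < η)
    (hc : ∀ k : ℕ, ∃ σ : Equiv.Perm (Fin m), c k = r (k / N) ∘ σ)
    (hmin : ∀ k : ℕ, ∀ σ : Equiv.Perm (Fin m),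
      dist (c k) (c (k + 1)) ≤ dist (c k) (r ((k + 1 : ℕ) / N) ∘ σ))
    {k k' : ℕ} (hkk : k ≤ k') (hk : |(k : ℝ) / N - s| < δ) (hk' : |(k' : ℝ) / N - s| < δ)
    (i : Fin m) : dist (c k i) (c k' i) ≤ 2 * η := by
  have near : ∀ l : ℕ, |(l : ℝ) / N - s| < δ →
      ∃ σ : Equiv.Perm (Fin m), ∀ i, ‖c l i - r s (σ i)‖ < η := by
    intro l hl
    obtain ⟨σ, hσ⟩ := hδ _ hl
    obtain ⟨τ, hτ⟩ := hc l
    refine ⟨τ.trans σ.symm, fun i => ?_⟩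
    have := hσ (σ.symm (τ i))
    simpa [hτ] using this
  have between : ∀ l : ℕ, k ≤ l → l ≤ k' → |(l : ℝ) / N - s| < δ := by
    intro l h1 h2
    have e1 : (k : ℝ) / N ≤ (l : ℝ) / N := by gcongr
    have e2 : (l : ℝ) / N ≤ (k' : ℝ) / N := by gcongr
    rw [abs_lt] at *
    constructor <;> linarith [hk.1, hk'.2]
  obtain ⟨σ₀, hσ₀⟩ := near k hk
  have step : ∀ l : ℕ, k ≤ l → l ≤ k' → ‖c l i - r s (σ₀ i)‖ < η := by
    intro l hl
    induction l, hl using Nat.le_induction with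
    | base => intro _; exact hσ₀ i
    | succ l hl ih =>
      intro hlk
      have ih := ih (by omega)
      obtain ⟨σ, hσ⟩ := near l (between l hl (by omega))
      obtain ⟨τ, hτ⟩ := hδ _ (between (l + 1) (by omega) hlk)
      have hη0 : 0 < η := (norm_nonneg _).trans_lt ih
      have hd : dist (c l) (c (l + 1)) ≤ 2 * η := by
        refine (hmin l (σ.trans τ)).trans ((dist_pi_le_iff (by positivity)).2 fun j => ?_)
        rw [dist_eq_norm]
        calc _ = ‖(c l j - r s (σ j)) - (r ((l + 1 : ℕ) / N) (τ (σ j)) - r s (σ j))‖ := by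
                simp
          _ ≤ _ := (norm_sub_le _ _).trans (by linarith [hσ j, hτ (σ j)])
      have hd := (dist_le_pi_dist _ _ i).trans hd
      rw [dist_eq_norm] at hd
      obtain ⟨ρ, hρ⟩ := near (l + 1) (between (l + 1) (by omega) hlk)
      -- The step contributes `2 * η` and each of the two endpoints `η`, which stays below the
      -- separation `4 * η`.
      have heq : r s (σ₀ i) = r s (ρ i) := by
        apply hη
        calc _ = ‖(c l i - c (l + 1) i) + (c (l + 1) i - r s (ρ i)) - (c l i - r s (σ₀ i))‖ := by
                congr 1; ring
          _ ≤ _ := norm_sub_le _ _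
          _ < 4 * η := by
            have := norm_add_le (c l i - c (l + 1) i) (c (l + 1) i - r s (ρ i))
            linarith [hρ i]
      rw [heq]
      exact hρ i
  rw [dist_eq_norm]
  calc _ = ‖(c k i - r s (σ₀ i)) - (c k' i - r s (σ₀ i))‖ := by congr 1; ring
    _ ≤ _ := norm_sub_le _ _
    _ ≤ 2 * η := by linarith [step k le_rfl hkk, step k' hkk le_rfl]

/-- Greedy chains on the grids of mesh `1 / N` converge along a nonprincipal ultrafilter, by local
boundedness. The uniform estimate of `chain_close` passes to the limit and gives continuity. -/
theorem exists_continuous_selection (hb : ∀ s > 0, ∃ R, ∀ᶠ t in 𝓝 s, ∀ i, ‖r t i‖ ≤ R)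
    (hc : ∀ s > 0, ∀ z, ContinuousAt (fun t => ∏ i, (z - r t i)) s) :
    ∃ x : ℝ → Fin m → ℂ, ∀ s > 0, ContinuousAt x s ∧
      ∃ σ : Equiv.Perm (Fin m), r s ∘ σ = x s := by
  choose c hcr hcm using fun N : ℕ => exists_matched_chain fun k : ℕ => r (k / N)
  have hgrid : ∀ t : ℝ, 0 < t →
      Tendsto (fun N : ℕ => ((⌊t * N⌋₊ : ℕ) : ℝ) / N) (hyperfilter ℕ) (𝓝 t) := fun t ht =>
    ((tendsto_nat_floor_mul_div_atTop ht.le).comp tendsto_natCast_atTop_atTop).mono_left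
      (by rw [← Nat.cofinite_eq_atTop]; exact hyperfilter_le_cofinite)
  have hlim : ∀ t : ℝ, ∃ y : Fin m → ℂ, 0 < t →
      Tendsto (fun N : ℕ => c N ⌊t * N⌋₊) (hyperfilter ℕ) (𝓝 y) := by
    intro t
    by_cases ht : 0 < t
    swap
    · exact ⟨0, fun h => absurd h ht⟩
    obtain ⟨R, hR⟩ := hb t ht
    obtain ⟨y, -, hy⟩ := (isCompact_univ_pi fun _ : Fin m =>
      isCompact_closedBall (0 : ℂ) R).ultrafilter_le_nhds'
        ((hyperfilter ℕ).map fun N : ℕ => c N ⌊t * N⌋₊) (by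
      rw [Ultrafilter.mem_map]
      filter_upwards [(hgrid t ht).eventually hR] with N hN i _
      obtain ⟨σ, hσ⟩ := hcr N ⌊t * N⌋₊
      simpa [hσ] using hN (σ i))
    exact ⟨y, fun _ => hy⟩
  choose x hx using hlim
  refine ⟨x, fun s hs => ⟨?_, ?_⟩⟩
  · rw [Metric.continuousAt_iff']
    intro ε hε
    obtain ⟨g, hg0, hg⟩ : ∃ g > 0, ∀ i j, ‖r s i - r s j‖ < g → r s i = r s j := by
      have : ∀ᶠ g in 𝓝[>] (0 : ℝ), ∀ i j, ‖r s i - r s j‖ < g → r s i = r s j := by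
        refine eventually_all.2 fun i => eventually_all.2 fun j => ?_
        by_cases h : r s i = r s j
        · simp [h]
        · have : 0 < ‖r s i - r s j‖ := norm_pos_iff.2 (sub_ne_zero.2 h)
          filter_upwards [Ioo_mem_nhdsGT this] with g hg hlt
          exact absurd hlt (not_lt.2 hg.2.le)
      obtain ⟨g, h1, h2⟩ := (this.and self_mem_nhdsWithin).exists
      exact ⟨g, h2, h1⟩
    -- `g` separates the distinct values of `r s`; `g / 4` meets the separation hypothesis of
    -- `chain_close`, and `ε / 4` makes its conclusion `2 * η` smaller than `ε`.
    set η := min (g / 4) (ε / 4) with hηdef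
    have hη : 0 < η := by positivity
    obtain ⟨δ, hδ0, hδ⟩ := Metric.eventually_nhds_iff.1
      (eventually_exists_perm_near (hb s hs) (hc s hs) hη)
    have hδ' : ∀ t, |t - s| < δ → ∃ σ : Equiv.Perm (Fin m), ∀ i, ‖r t (σ i) - r s i‖ < η :=
      fun t ht => hδ ht
    have hwin : ∀ t, 0 < t → |t - s| < δ →
        ∀ᶠ N : ℕ in (hyperfilter ℕ : Filter ℕ), |((⌊t * N⌋₊ : ℕ) : ℝ) / N - s| < δ :=
      fun t ht hts => (hgrid t ht).eventually
        (Metric.isOpen_ball.mem_nhds (show t ∈ Metric.ball s δ from hts))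
    filter_upwards [Metric.ball_mem_nhds s hδ0, lt_mem_nhds hs] with t ht ht0
    have hle : dist (x t) (x s) ≤ 2 * η := by
      refine le_of_tendsto ((hx t ht0).dist (hx s hs)) ?_
      filter_upwards [hwin t ht0 ht, hwin s hs (by simpa using hδ0)] with N h1 h2
      refine (dist_pi_le_iff (by positivity)).2 fun i => ?_
      have key : ∀ {k k' : ℕ}, k ≤ k' → |(k : ℝ) / N - s| < δ → |(k' : ℝ) / N - s| < δ →
          dist (c N k i) (c N k' i) ≤ 2 * η := fun hkk h1 h2 =>
        chain_close (fun i j hij => hg i j (hij.trans_le (by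
          linarith [min_le_left (g / 4) (ε / 4)]))) hδ' (hcr N) (hcm N) hkk h1 h2 i
      rcases le_total ⌊t * N⌋₊ ⌊s * N⌋₊ with h | h
      · exact key h h1 h2
      · rw [dist_comm]; exact key h h2 h1
    linarith [min_le_right (g / 4) (ε / 4)]
  · refine exists_perm_of_map_eq (map_eq_of_prod_sub_eq fun z => ?_)
    have h1 : Tendsto (fun N : ℕ => ∏ i, (z - c N ⌊s * N⌋₊ i)) (hyperfilter ℕ)
        (𝓝 (∏ i, (z - x s i))) :=
      tendsto_finsetProd _ fun i _ => tendsto_const_nhds.sub ((tendsto_pi_nhds.1 (hx s hs)) i)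
    have h2 := (hc s hs z).tendsto.comp (hgrid s hs)
    refine tendsto_nhds_unique h1 (h2.congr fun N => ?_)
    obtain ⟨σ, hσ⟩ := hcr N ⌊s * N⌋₊
    simp only [Function.comp_apply, hσ]
    exact (Equiv.prod_comp σ fun i => z - r (⌊s * N⌋₊ / N) i).symm

end Selection

/-! ### The eigenvalues as germs -/

theorem exists_roots_family {n : ℕ} (M : Matrix (Fin n) (Fin n) ℂ) :
    ∃ f : Fin n → ℂ, M.charpoly.roots = Finset.univ.val.map f := by
  have hcard : M.charpoly.roots.card = n := by
    rw [← (IsAlgClosed.splits M.charpoly).natDegree_eq_card_roots, Matrix.charpoly_natDegree_eq_dim,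
      Fintype.card_fin]
  generalize M.charpoly.roots = s at hcard
  induction s using Quotient.inductionOn with
  | h l =>
    have hl : l.length = n := hcard
    subst hl
    exact ⟨l.get, by rw [Fin.univ_val_map, List.ofFn_get]; rfl⟩

theorem eval_charpoly_eq_prod {n : ℕ} {M : Matrix (Fin n) (Fin n) ℂ} {f : Fin n → ℂ}
    (h : M.charpoly.roots = Finset.univ.val.map f) (z : ℂ) :
    (Matrix.scalar (Fin n) z - M).det = ∏ i, (z - f i) := by
  rw [← Matrix.eval_charpoly, (IsAlgClosed.splits M.charpoly).eq_prod_roots_of_monic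
    M.charpoly_monic, h, Multiset.map_map, Polynomial.eval_multiset_prod, Multiset.map_map]
  simp [Finset.prod]

/-- Compare both sides of the eigenvector equation at a coordinate of maximal modulus. -/
theorem norm_le_of_mem_roots_charpoly {n : ℕ} {M : Matrix (Fin n) (Fin n) ℂ} {b : ℝ}
    (hb : ∀ i j, ‖M i j‖ ≤ b) {μ : ℂ} (hμ : μ ∈ M.charpoly.roots) : ‖μ‖ ≤ n * b := by
  have h0 : (Matrix.scalar (Fin n) μ - M).det = 0 := by
    rw [← Matrix.eval_charpoly]
    exact (Polynomial.mem_roots'.1 hμ).2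
  obtain ⟨v, hv, hMv⟩ := Matrix.exists_mulVec_eq_zero_iff.2 h0
  have : Nonempty (Fin n) := by
    by_contra h
    rw [not_nonempty_iff] at h
    exact hv (Subsingleton.elim _ _)
  obtain ⟨i, hi⟩ := Finite.exists_max fun i => ‖v i‖
  have hpos : 0 < ‖v i‖ := by
    obtain ⟨j, hj⟩ := Function.ne_iff.1 hv
    exact (norm_pos_iff.2 hj).trans_le (hi j)
  have heq : μ * v i = ∑ j, M i j * v j := by
    have := congrFun hMv i
    rw [Matrix.sub_mulVec, Matrix.scalar_apply, Pi.sub_apply, Matrix.mulVec_diagonal] at this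
    simpa [sub_eq_zero, Matrix.mulVec, dotProduct] using this
  refine le_of_mul_le_mul_right ?_ hpos
  rw [← norm_mul, heq]
  calc _ ≤ ∑ j, ‖M i j * v j‖ := norm_sum_le _ _
    _ ≤ ∑ _j : Fin n, b * ‖v i‖ := Finset.sum_le_sum fun j _ => by
      rw [norm_mul]
      exact mul_le_mul (hb i j) (hi j) (norm_nonneg _) ((norm_nonneg _).trans (hb i j))
    _ = _ := by simp [mul_assoc]

/-- The condition `ε₁ ≤ 1 / (n + 1)` lets one more power of `ε⁻¹` absorb the factor `n` in the bound
for the eigenvalues. -/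
theorem exists_uniform_bound {n : ℕ} {𝒜 : ℝ → Matrix (Fin n) (Fin n) ℂ}
    (h𝒜 : ∀ i j, ClassC fun ε => 𝒜 ε i j) :
    ∃ ε₁ > 0, ε₁ ≤ 1 / ((n : ℝ) + 1) ∧ ∃ K : ℝ, 0 < K ∧
      (∀ i j, ContinuousOn (fun ε => 𝒜 ε i j) (Set.Ioo 0 ε₁)) ∧
      ∀ ε ∈ Set.Ioo 0 ε₁, ∀ i j, ‖𝒜 ε i j‖ ≤ ε ^ (-K) := by
  choose e he hcont k hk hbd using h𝒜
  have hev : ∀ᶠ ε₁ in 𝓝[>] (0 : ℝ), ∀ i j, ε₁ ≤ e i j :=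
    eventually_all.2 fun i => eventually_all.2 fun j => by
      filter_upwards [Ioo_mem_nhdsGT (he i j)] with x hx using hx.2.le
  have hn : (0 : ℝ) < 1 / ((n : ℝ) + 1) := by positivity
  obtain ⟨ε₁, h1, h3⟩ := (hev.and (Ioo_mem_nhdsGT hn)).exists
  refine ⟨ε₁, h3.1, h3.2.le, 1 + ∑ i, ∑ j, k i j, ?_, fun i j => (hcont i j).mono ?_, ?_⟩
  · have : 0 ≤ ∑ i, ∑ j, k i j := Finset.sum_nonneg fun i _ => Finset.sum_nonneg fun j _ => (hk i j).le
    linarith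
  · exact Set.Ioo_subset_Ioo_right (h1 i j)
  · intro ε hε i j
    refine (hbd i j ε ⟨hε.1, hε.2.trans_le (h1 i j)⟩).trans ?_
    have h1' : ε ≤ 1 := by
      have : 1 / ((n : ℝ) + 1) ≤ 1 := by
        rw [div_le_one (by positivity)]; linarith [n.cast_nonneg (α := ℝ)]
      linarith [hε.2, h3.2]
    refine Real.rpow_le_rpow_of_exponent_ge hε.1 h1' ?_
    have h2 : k i j ≤ ∑ j, k i j := Finset.single_le_sum (fun j _ => (hk i j).le) (Finset.mem_univ j)
    have h3 : ∑ j, k i j ≤ ∑ i, ∑ j, k i j := Finset.single_le_sum (f := fun i => ∑ j, k i j)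
      (fun i _ => Finset.sum_nonneg fun j _ => (hk i j).le) (Finset.mem_univ i)
    linarith

theorem exists_isEigenvalueFamily {n : ℕ} {𝒜 : ℝ → Matrix (Fin n) (Fin n) ℂ}
    (h𝒜 : ∀ i j, ClassC fun ε => 𝒜 ε i j) : ∃ ev : Fin n → ℝ → ℂ, IsEigenvalueFamily 𝒜 ev := by
  obtain ⟨ε₁, h0, hn, K, hK, hcont, hbd⟩ := exists_uniform_bound h𝒜
  choose f hf using fun M : Matrix (Fin n) (Fin n) ℂ => exists_roots_family M
  have hmem : ∀ M i, f M i ∈ M.charpoly.roots := fun M i => by rw [hf]; simp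
  -- This substitution turns `(0, ε₁)` into the half-line `t > 0` on which the selection is made;
  -- `q` below is its inverse.
  set p : ℝ → ℝ := fun t => ε₁ * Real.exp (-t) with hp
  have hpc : Continuous p := by fun_prop
  have hpm : ∀ t > 0, p t ∈ Set.Ioo 0 ε₁ := fun t ht =>
    ⟨by positivity, by
      have := Real.exp_lt_one_iff.2 (neg_lt_zero.2 ht)
      simp only [hp]; nlinarith⟩
  have hAc : ∀ s > 0, ContinuousAt (fun t => 𝒜 (p t)) s := fun s hs =>
    continuousAt_pi.2 fun i => continuousAt_pi.2 fun j =>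
      ((hcont i j).continuousAt (isOpen_Ioo.mem_nhds (hpm s hs))).comp (f := p) hpc.continuousAt
  obtain ⟨x, hx⟩ := exists_continuous_selection (r := fun t => f (𝒜 (p t)))
    (fun s hs => ⟨n * ((p s / 2) ^ (-K)), by
      have h2 : ∀ᶠ t in 𝓝 s, p s / 2 < p t :=
        hpc.continuousAt.eventually (lt_mem_nhds (by linarith [(hpm s hs).1]))
      filter_upwards [h2, lt_mem_nhds hs] with t ht1 ht2 i
      refine norm_le_of_mem_roots_charpoly (fun i j => (hbd _ (hpm t ht2) i j).trans ?_) (hmem _ i)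
      exact Real.rpow_le_rpow_of_nonpos (by linarith [(hpm s hs).1]) ht1.le (by linarith)⟩)
    (fun s hs z => by
      simp only [← eval_charpoly_eq_prod (hf _)]
      exact (Continuous.matrix_det continuous_id).continuousAt.comp
        (continuousAt_const.sub (hAc s hs)))
  set q : ℝ → ℝ := fun ε => -Real.log (ε / ε₁) with hq
  have hqp : ∀ ε ∈ Set.Ioo 0 ε₁, 0 < q ε ∧ p (q ε) = ε := by
    intro ε hε
    have h1 : 0 < ε / ε₁ := div_pos hε.1 h0
    refine ⟨neg_pos.2 (Real.log_neg h1 ((div_lt_one h0).2 hε.2)), ?_⟩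
    simp only [hp, hq, neg_neg, Real.exp_log h1]
    field_simp
  have hroots : ∀ ε ∈ Set.Ioo 0 ε₁, (𝒜 ε).charpoly.roots =
      Finset.univ.val.map fun i => x (q ε) i := by
    intro ε hε
    obtain ⟨h1, h2⟩ := hqp ε hε
    obtain ⟨σ, hσ⟩ := (hx _ h1).2
    rw [hf (𝒜 ε), ← hσ, h2]
    change _ = Multiset.map (f (𝒜 ε) ∘ σ) _
    rw [← Multiset.map_map (f (𝒜 ε)) σ]
    congr 1
    exact (congrArg Finset.val (Finset.map_univ_equiv σ)).symm
  refine ⟨fun i ε => x (q ε) i, fun i => ⟨ε₁, h0, ?_, K + 1, by linarith, ?_⟩, ?_⟩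
  · intro ε hε
    have hqc : ContinuousAt q ε :=
      ((continuousAt_id.div_const ε₁).log (div_pos hε.1 h0).ne').neg
    have := ContinuousAt.comp (f := q) (hx _ (hqp ε hε).1).1 hqc
    exact (continuousAt_pi.1 this i).continuousWithinAt
  · intro ε hε
    have hm : x (q ε) i ∈ (𝒜 ε).charpoly.roots := by rw [hroots ε hε]; simp
    refine (norm_le_of_mem_roots_charpoly (hbd ε hε) hm).trans ?_
    have h1 : (n : ℝ) ≤ ε⁻¹ := by
      rw [le_inv_comm₀ (by
        have : 0 < n := (Nat.zero_le _).trans_lt i.2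
        exact_mod_cast this) hε.1]
      refine (hε.2.le.trans hn).trans ?_
      rw [one_div]
      have : (0 : ℝ) < n := by exact_mod_cast (Nat.zero_le _).trans_lt i.2
      exact inv_anti₀ this (by linarith)
    calc (n : ℝ) * ε ^ (-K) ≤ ε⁻¹ * ε ^ (-K) :=
          mul_le_mul_of_nonneg_right h1 (Real.rpow_nonneg hε.1.le _)
      _ = ε ^ (-(K + 1)) := by
          rw [← Real.rpow_neg_one, ← Real.rpow_add hε.1]
          congr 1; ring
  · filter_upwards [Ioo_mem_nhdsGT h0] with ε hε using hroots ε hε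

/-! ### Limits of families of roots -/

/-- Dividing by the value at a base point `x₀` cancels the unknown factor `g`. The factors whose
root escapes to infinity then tend to `1`, and the others determine `Q` up to a constant. -/
theorem roots_eq_of_tendsto {m : ℕ} {F : Filter ℝ} [F.NeBot] {y : Fin m → ℝ → ℂ} {g : ℝ → ℂ}
    {Q : Polynomial ℂ} (hQ : Q ≠ 0)
    (h : ∀ z, Tendsto (fun ε => g ε * ∏ i, (z - y i ε)) F (𝓝 (Q.eval z)))
    {S : Finset (Fin m)} {l : Fin m → ℂ} (hS : ∀ i ∈ S, Tendsto (y i) F (𝓝 (l i)))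
    (hS' : ∀ i ∉ S, Tendsto (fun ε => ‖y i ε‖) F atTop) : Q.roots = S.val.map l := by
  obtain ⟨x₀, hx₀⟩ := Infinite.exists_notMem_finset (Q.roots.toFinset ∪ S.image l)
  simp only [Finset.mem_union, Multiset.mem_toFinset, Finset.mem_image, not_or, not_exists,
    not_and] at hx₀
  have hQ0 : Q.eval x₀ ≠ 0 := fun h => hx₀.1 ((Polynomial.mem_roots hQ).2 h)
  have hl0 : ∀ i ∈ S, x₀ - l i ≠ 0 := fun i hi h => hx₀.2 i hi (sub_eq_zero.1 h).symm
  have key : ∀ x, Q.eval x / Q.eval x₀ = ∏ i ∈ S, ((x - l i) / (x₀ - l i)) := by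
    intro x
    have h1 : Tendsto (fun ε => ∏ i, ((x - y i ε) / (x₀ - y i ε))) F
        (𝓝 (∏ i, if i ∈ S then (x - l i) / (x₀ - l i) else 1)) := by
      refine tendsto_finsetProd _ fun i _ => ?_
      by_cases hi : i ∈ S
      · rw [if_pos hi]
        exact (tendsto_const_nhds.sub (hS i hi)).div (tendsto_const_nhds.sub (hS i hi)) (hl0 i hi)
      · rw [if_neg hi]
        have hinf : Tendsto (fun ε => ‖x₀ - y i ε‖) F atTop := by
          refine tendsto_atTop_mono (fun ε => ?_)
            (tendsto_atTop_add_const_right _ (-‖x₀‖) (hS' i hi))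
          have := norm_sub_norm_le (y i ε) x₀
          rw [norm_sub_rev] at this
          linarith
        have hz : Tendsto (fun ε => (x₀ - y i ε)⁻¹) F (𝓝 0) :=
          tendsto_zero_iff_norm_tendsto_zero.2
            ((tendsto_inv_atTop_zero.comp hinf).congr fun ε => by simp)
        have h3 : Tendsto (fun ε => 1 + (x - x₀) * (x₀ - y i ε)⁻¹) F (𝓝 (1 + (x - x₀) * 0)) :=
          tendsto_const_nhds.add (tendsto_const_nhds.mul hz)
        rw [mul_zero, add_zero] at h3
        refine h3.congr' ?_
        filter_upwards [hinf.eventually_gt_atTop 0] with ε hε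
        have : x₀ - y i ε ≠ 0 := norm_pos_iff.1 hε
        field_simp
        ring
    have h2 : Tendsto (fun ε => ∏ i, ((x - y i ε) / (x₀ - y i ε))) F
        (𝓝 (Q.eval x / Q.eval x₀)) := by
      refine ((h x).div (h x₀) hQ0).congr' ?_
      filter_upwards [(h x₀).eventually_ne hQ0] with ε hε
      rw [Pi.div_apply, mul_div_mul_left _ _ (left_ne_zero_of_mul hε), Finset.prod_div_distrib]
    rw [tendsto_nhds_unique h2 h1, Finset.prod_ite_mem, Finset.univ_inter]
  have hP : Q = Polynomial.C (Q.eval x₀ / ∏ i ∈ S, (x₀ - l i)) *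
      ∏ i ∈ S, (Polynomial.X - Polynomial.C (l i)) := by
    apply Polynomial.funext
    intro x
    have := key x
    rw [Finset.prod_div_distrib, div_eq_iff hQ0] at this
    rw [this]
    simp only [Polynomial.eval_mul, Polynomial.eval_C, Polynomial.eval_prod, Polynomial.eval_sub,
      Polynomial.eval_X]
    ring
  rw [hP, Polynomial.roots_C_mul _ (div_ne_zero hQ0 (Finset.prod_ne_zero_iff.2 hl0)),
    roots_prod_X_sub_C_family]

/-- Take disjoint neighbourhoods of the finitely many possible limits. Near `0` the values of `f`
lie in their union, and the image of a small interval is connected, so it stays in one of them. -/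
theorem exists_tendsto_of_finite_limits {X : Type*} [TopologicalSpace X] [T2Space X]
    [CompactSpace X] {f : ℝ → X} {ε₁ : ℝ} (h0 : 0 < ε₁) (hf : ContinuousOn f (Set.Ioo 0 ε₁))
    {E : Set X} (hE : E.Finite)
    (hlim : ∀ U : Ultrafilter ℝ, (U : Filter ℝ) ≤ 𝓝[>] 0 → ∃ p ∈ E, Tendsto f U (𝓝 p)) :
    ∃ p ∈ E, Tendsto f (𝓝[>] 0) (𝓝 p) := by
  obtain ⟨O, hO, hdisj⟩ := hE.t2_separation
  obtain ⟨U₀, hU₀⟩ := Ultrafilter.exists_le (𝓝[>] (0 : ℝ))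
  obtain ⟨p, hp, hU₀p⟩ := hlim U₀ hU₀
  refine ⟨p, hp, ?_⟩
  have hcov : ∀ᶠ ε in 𝓝[>] (0 : ℝ), f ε ∈ ⋃ q ∈ E, O q := by
    by_contra hcon
    rw [not_eventually, frequently_iff_neBot] at hcon
    obtain ⟨U, hU⟩ := Ultrafilter.exists_le (𝓝[>] (0 : ℝ) ⊓ 𝓟 {t | ¬ f t ∈ ⋃ q ∈ E, O q})
    obtain ⟨q, hq, hUq⟩ := hlim U (hU.trans inf_le_left)
    have h1 : ∀ᶠ t in (U : Filter ℝ), f t ∉ ⋃ q ∈ E, O q :=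
      (hU.trans inf_le_right) (mem_principal_self _)
    obtain ⟨t, h2, h3⟩ := (h1.and (hUq.eventually ((hO q).2.mem_nhds (hO q).1))).exists
    exact h2 (Set.mem_biUnion hq h3)
  obtain ⟨δ, hδ, hδs⟩ := mem_nhdsGT_iff_exists_Ioo_subset.1
    (hcov.and (Ioo_mem_nhdsGT h0))
  have hsub : f '' Set.Ioo 0 δ ⊆ O p := by
    refine IsPreconnected.subset_left_of_subset_union (hO p).2
      (v := ⋃ q ∈ E \ {p}, O q) (isOpen_biUnion fun q _ => (hO q).2) ?_ ?_ ?_ ?_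
    · rw [Set.disjoint_iUnion₂_right]
      exact fun q hq => hdisj hp hq.1 (Ne.symm hq.2)
    · rintro _ ⟨t, ht, rfl⟩
      obtain ⟨q, hq, hq'⟩ := Set.mem_iUnion₂.1 (hδs ht).1
      by_cases hqp : q = p
      · exact Or.inl (hqp ▸ hq')
      · exact Or.inr (Set.mem_biUnion ⟨hq, hqp⟩ hq')
    · obtain ⟨t, h1, h2⟩ := ((hU₀p.eventually ((hO p).2.mem_nhds (hO p).1)).and
        (hU₀ (Ioo_mem_nhdsGT (Set.mem_Ioi.1 hδ)))).exists
      exact ⟨f t, ⟨t, h2, rfl⟩, h1⟩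
    · exact isPreconnected_Ioo.image _ (hf.mono fun t ht => (hδs ht).2)
  rw [tendsto_iff_ultrafilter]
  intro U hU
  obtain ⟨q, hq, hUq⟩ := hlim U hU
  by_cases hqp : q = p
  · exact hqp ▸ hUq
  · obtain ⟨t, h1, h2⟩ := ((hUq.eventually ((hO q).2.mem_nhds (hO q).1)).and
        (hU (Ioo_mem_nhdsGT (Set.mem_Ioi.1 hδ)))).exists
    exact absurd (hsub ⟨t, h2, rfl⟩) (Set.disjoint_left.1 (hdisj hq hp hqp) h1)

theorem onePoint_tendsto_cases {f : ℝ → ℂ} {F : Filter ℝ} {p : OnePoint ℂ}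
    (h : Tendsto (fun ε => (f ε : OnePoint ℂ)) F (𝓝 p)) :
    (p = OnePoint.infty ∧ Tendsto (fun ε => ‖f ε‖) F atTop) ∨
      ∃ z : ℂ, p = z ∧ Tendsto f F (𝓝 z) := by
  induction p using OnePoint.rec with
  | infty =>
    refine Or.inl ⟨rfl, ?_⟩
    have h1 : Tendsto f F (comap OnePoint.some (𝓝 OnePoint.infty)) := tendsto_comap_iff.2 h
    rw [OnePoint.comap_coe_nhds_infty, coclosedCompact_eq_cocompact] at h1
    exact tendsto_norm_cocompact_atTop.comp h1
  | coe z => exact Or.inr ⟨z, rfl, OnePoint.isOpenEmbedding_coe.tendsto_nhds_iff.2 h⟩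

/-- In the one-point compactification every `y i` converges along every ultrafilter, and
`roots_eq_of_tendsto` confines the limit to the finite set of roots of `Q` and infinity. Continuity
upgrades this to convergence at `0⁺`. -/
theorem exists_limits_of_roots {m : ℕ} {y : Fin m → ℝ → ℂ} {g : ℝ → ℂ} {Q : Polynomial ℂ}
    (hQ : Q ≠ 0) {ε₁ : ℝ} (h0 : 0 < ε₁) (hy : ∀ i, ContinuousOn (y i) (Set.Ioo 0 ε₁))
    (h : ∀ z, Tendsto (fun ε => g ε * ∏ i, (z - y i ε)) (𝓝[>] 0) (𝓝 (Q.eval z))) :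
    ∃ (S : Finset (Fin m)) (l : Fin m → ℂ), (∀ i ∈ S, Tendsto (y i) (𝓝[>] 0) (𝓝 (l i))) ∧
      (∀ i ∉ S, Tendsto (fun ε => ‖y i ε‖) (𝓝[>] 0) atTop) ∧ Q.roots = S.val.map l := by
  classical
  -- Used twice: along ultrafilters, to locate the possible limits, and along `𝓝[>] 0` itself, for
  -- the conclusion.
  have pack : ∀ F : Filter ℝ, F.NeBot → F ≤ 𝓝[>] 0 →
      (∀ i, ∃ p : OnePoint ℂ, Tendsto (fun ε => (y i ε : OnePoint ℂ)) F (𝓝 p)) →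
      ∃ (S : Finset (Fin m)) (l : Fin m → ℂ), (∀ i ∈ S, Tendsto (y i) F (𝓝 (l i))) ∧
      (∀ i ∉ S, Tendsto (fun ε => ‖y i ε‖) F atTop) ∧ Q.roots = S.val.map l := by
    intro F hF hle hp
    have hcase : ∀ i, ∃ l : ℂ, ¬ Tendsto (fun ε => ‖y i ε‖) F atTop → Tendsto (y i) F (𝓝 l) := by
      intro i
      obtain ⟨p, hp⟩ := hp i
      rcases onePoint_tendsto_cases hp with ⟨-, h1⟩ | ⟨z, -, hz⟩
      · exact ⟨0, fun h => absurd h1 h⟩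
      · exact ⟨z, fun _ => hz⟩
    choose l hl using hcase
    have h1 : ∀ i ∈ Finset.univ.filter (fun i => ¬ Tendsto (fun ε => ‖y i ε‖) F atTop),
        Tendsto (y i) F (𝓝 (l i)) := fun i hi => hl i (Finset.mem_filter.1 hi).2
    have h2 : ∀ i ∉ Finset.univ.filter (fun i => ¬ Tendsto (fun ε => ‖y i ε‖) F atTop),
        Tendsto (fun ε => ‖y i ε‖) F atTop := fun i hi => by simpa using hi
    exact ⟨_, l, h1, h2, roots_eq_of_tendsto hQ (fun z => (h z).mono_left hle) h1 h2⟩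
  refine pack _ inferInstance le_rfl fun i => ?_
  obtain ⟨p, -, hp⟩ := exists_tendsto_of_finite_limits
    (f := fun ε => (y i ε : OnePoint ℂ)) h0 (OnePoint.continuous_coe.comp_continuousOn (hy i))
    (E := {OnePoint.infty} ∪ OnePoint.some '' (Q.roots.toFinset : Set ℂ))
    ((Set.finite_singleton _).union (Q.roots.toFinset.finite_toSet.image _)) (by
      intro U hU
      obtain ⟨S, l, h1, h2, h3⟩ := pack U U.neBot hU fun i =>
        ⟨_, (U.map fun ε => (y i ε : OnePoint ℂ)).le_nhds_lim⟩
      by_cases hi : i ∈ S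
      · refine ⟨l i, Or.inr ⟨l i, ?_, rfl⟩, (OnePoint.continuous_coe.tendsto _).comp (h1 i hi)⟩
        rw [Finset.mem_coe, Multiset.mem_toFinset, h3]
        exact Multiset.mem_map_of_mem l hi
      · refine ⟨OnePoint.infty, Or.inl rfl, ?_⟩
        have hc : Tendsto (y i) U (coclosedCompact ℂ) := by
          rw [coclosedCompact_eq_cocompact, ← Metric.cobounded_eq_cocompact, ← comap_norm_atTop,
            tendsto_comap_iff]
          exact h2 i hi
        exact OnePoint.tendsto_coe_infty.comp hc)
  exact ⟨p, hp⟩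

/-! ### Walks and circuits -/

/-- Applying `σ` another `orderOf σ - 1` times leads from `σ x` back to `x`. This closes circuits,
both for rotations of a closed sequence and for permutations in a determinant. -/
theorem reflTransGen_of_perm {ι : Type*} [Finite ι] {R : ι → ι → Prop} (σ : Equiv.Perm ι)
    (h : ∀ x, ReflTransGen R x (σ x)) (x : ι) : ReflTransGen R (σ x) x := by
  have key : ∀ (m : ℕ) y, ReflTransGen R y ((σ ^ m) y) := by
    intro m
    induction m with
    | zero => intro y; exact .refl
    | succ m ih =>
      intro y
      rw [pow_succ', Equiv.Perm.mul_apply]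
      exact (ih y).trans (h _)
  have h1 := key (orderOf σ - 1) (σ x)
  rwa [← Equiv.Perm.mul_apply, ← pow_succ, Nat.sub_add_cancel (orderOf_pos σ),
    pow_orderOf_eq_one] at h1

theorem exists_walk_of_transGen {α : Type*} {R : α → α → Prop} {i j : α} (h : TransGen R i j) :
    ∃ k > 0, ∃ f : ℕ → α, f 0 = i ∧ f k = j ∧ ∀ m < k, R (f m) (f (m + 1)) := by
  induction h with
  | single h => exact ⟨1, one_pos, fun m => if m = 0 then i else _, rfl, rfl, by simpa using h⟩
  | @tail b c _ hbc ih =>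
    obtain ⟨k, hk, f, h0, hfk, hf⟩ := ih
    refine ⟨k + 1, by omega, fun m => if m ≤ k then f m else c, by simp [h0], by simp, ?_⟩
    intro m hm
    rcases Nat.lt_succ_iff_lt_or_eq.1 hm with h | rfl
    · have := hf m h
      simpa [h.le, Nat.succ_le_of_lt h] using this
    · simpa [hfk] using hbc

theorem walk_finRotate {α : Type*} {k : ℕ} {f : ℕ → α} (hf : f k = f 0) (m : Fin k) :
    f (finRotate k m) = f (m + 1) := by
  obtain _ | k := k
  · exact m.elim0
  · by_cases hm : m = Fin.last k
    · subst hm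
      simp [hf]
    · rw [coe_finRotate_of_ne_last hm]

theorem exists_eq_of_inf_eq_coe {ι : Type*} {s : Finset ι} {f : ι → WithTop ℝ} {x : ℝ}
    (h : s.inf f = x) : ∃ i ∈ s, f i = x := by
  rcases s.eq_empty_or_nonempty with rfl | hs
  · simp at h
  · obtain ⟨i, hi, h1⟩ := s.exists_mem_eq_inf hs f
    exact ⟨i, hi, h1 ▸ h⟩

theorem circuitWeight_eq_coe {B : Matrix (Fin n) (Fin n) (WithTop ℝ)} {k : ℕ} {c : Fin k → Fin n}
    {w : Fin k → ℝ} (h : ∀ m, B (c m) (c (finRotate k m)) = w m) :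
    circuitWeight B c = ((∑ m, w m : ℝ) : WithTop ℝ) := by
  rw [circuitWeight, WithTop.coe_sum]
  exact Finset.sum_congr rfl fun m _ => h m

theorem exists_arc_weights {B : Matrix (Fin n) (Fin n) (WithTop ℝ)} {k : ℕ} {c : Fin k → Fin n}
    {W : ℝ} (h : circuitWeight B c = W) :
    ∃ w : Fin k → ℝ, (∀ m, B (c m) (c (finRotate k m)) = w m) ∧ ∑ m, w m = W := by
  have hne : ∀ m, B (c m) (c (finRotate k m)) ≠ ⊤ := fun m hm => by
    have : circuitWeight B c = ⊤ := WithTop.sum_eq_top.2 ⟨m, Finset.mem_univ _, hm⟩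
    simp [h] at this
  refine ⟨fun m => (B (c m) (c (finRotate k m))).untop (hne m), fun m => (WithTop.coe_untop _ _).symm, ?_⟩
  rw [← WithTop.coe_inj, ← h]
  exact (circuitWeight_eq_coe fun m => (WithTop.coe_untop _ _).symm).symm

theorem circuitMean_eq_coe {B : Matrix (Fin n) (Fin n) (WithTop ℝ)} {k : ℕ} {c : Fin k → Fin n}
    (hk : 0 < k) {x : ℝ} :
    circuitMean B c = x ↔ circuitWeight B c = ((k * x : ℝ) : WithTop ℝ) := by
  have hk' : (k : ℝ) ≠ 0 := by positivity
  rw [circuitMean]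
  induction circuitWeight B c using WithTop.recTopCoe with
  | top => exact iff_of_false WithTop.top_ne_coe WithTop.top_ne_coe
  | coe w =>
    rw [WithTop.map_coe, WithTop.coe_inj, WithTop.coe_inj, div_eq_iff hk', mul_comm]

theorem rhoMin_le {L : Finset (Fin n)} {B : Matrix (Fin n) (Fin n) (WithTop ℝ)} {k : ℕ}
    (hk : 0 < k) (hkL : k ≤ L.card) {c : Fin k → Fin n} (hc : ∀ m, c m ∈ L) :
    rhoMin L B ≤ circuitMean B c :=
  (Finset.inf_le (Finset.mem_Icc.2 ⟨hk, hkL⟩)).trans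
    (Finset.inf_le (Fintype.mem_piFinset.2 hc))

theorem exists_circuit_eq_rhoMin {L : Finset (Fin n)} {B : Matrix (Fin n) (Fin n) (WithTop ℝ)}
    {ρ : ℝ} (h : rhoMin L B = ρ) : ∃ k, 0 < k ∧ k ≤ L.card ∧ ∃ c : Fin k → Fin n,
      (∀ m, c m ∈ L) ∧ ∃ w : Fin k → ℝ, (∀ m, B (c m) (c (finRotate k m)) = w m) ∧
        ∑ m, w m = k * ρ := by
  obtain ⟨k, hk, h1⟩ := exists_eq_of_inf_eq_coe h
  obtain ⟨c, hc, h2⟩ := exists_eq_of_inf_eq_coe h1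
  rw [Finset.mem_Icc] at hk
  exact ⟨k, hk.1, hk.2, c, Fintype.mem_piFinset.1 hc,
    exists_arc_weights ((circuitMean_eq_coe hk.1).1 h2)⟩

/-- Following successors inside `L`, a node repeats within `L.card` steps, which gives a closed walk
short enough to be counted in `rhoMin`. -/
theorem rhoMin_ne_top {L : Finset (Fin n)} {B : Matrix (Fin n) (Fin n) (WithTop ℝ)}
    (hL : L.Nonempty) (h : ∀ i ∈ L, ∃ j ∈ L, B i j ≠ ⊤) : rhoMin L B ≠ ⊤ := by
  choose! s hs hB using h
  obtain ⟨i, hi⟩ := hL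
  have hmem : ∀ m : ℕ, s^[m] i ∈ L := by
    intro m
    induction m with
    | zero => exact hi
    | succ m ih => rw [Function.iterate_succ_apply']; exact hs _ ih
  obtain ⟨a, ha, b, hb, hab, heq⟩ := Finset.exists_ne_map_eq_of_card_lt_of_maps_to
    (s := Finset.range (L.card + 1)) (t := L) (f := fun m => s^[m] i) (by simp)
    (fun m _ => hmem m)
  wlog hlt : a < b generalizing a b
  · exact this b hb a ha hab.symm heq.symm (by omega)
  rw [Finset.mem_range] at ha hb
  set f : ℕ → Fin n := fun m => s^[a + m] i
  have hf : f (b - a) = f 0 := by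
    change s^[a + (b - a)] i = s^[a + 0] i
    rw [Nat.add_sub_cancel' hlt.le, add_zero]
    exact heq.symm
  have hle : rhoMin L B ≤ circuitMean B (fun m : Fin (b - a) => f m) :=
    rhoMin_le (by omega) (by omega) fun m => hmem _
  refine ne_top_of_le_ne_top ?_ hle
  rw [circuitMean, Ne, WithTop.map_eq_top_iff, circuitWeight, WithTop.sum_eq_top]
  rintro ⟨m, -, hm⟩
  rw [walk_finRotate hf] at hm
  refine hB _ (hmem (a + m)) ?_
  rw [← Function.iterate_succ_apply' s]
  exact hm

/-- Shortest walk potentials: if no short closed walk in `L` has negative weight, the arc weights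
can be bounded below by differences of a potential. -/
theorem exists_potential_of_closed_walks {L : Finset (Fin n)} {E : Fin n → Fin n → Prop}
    {w : Fin n → Fin n → ℝ}
    (h : ∀ k, 0 < k → k ≤ L.card → ∀ f : ℕ → Fin n, f k = f 0 → (∀ m ≤ k, f m ∈ L) →
      (∀ m < k, E (f m) (f (m + 1))) → 0 ≤ ∑ m ∈ Finset.range k, w (f m) (f (m + 1))) :
    ∃ U : Fin n → ℝ, ∀ i ∈ L, ∀ j ∈ L, E i j → U i ≤ w i j + U j := by
  -- The weights of the walks from `i` that repeat no node; their length is less than `L.card`, so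
  -- `W i` is bounded below. The potential is its infimum.
  set W : Fin n → Set ℝ := fun i => {x | ∃ (k : ℕ) (f : ℕ → Fin n), f 0 = i ∧ (∀ m ≤ k, f m ∈ L) ∧
    Set.InjOn f (Set.Iic k) ∧ (∀ m < k, E (f m) (f (m + 1))) ∧
    x = ∑ m ∈ Finset.range k, w (f m) (f (m + 1))} with hW
  have hlen : ∀ (k : ℕ) (f : ℕ → Fin n), (∀ m ≤ k, f m ∈ L) → Set.InjOn f (Set.Iic k) →
      k + 1 ≤ L.card := by
    intro k f h1 h2
    have := Finset.card_le_card_of_injOn (s := Finset.range (k + 1)) (t := L) f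
      (fun m hm => h1 m (by simpa [Nat.lt_succ_iff] using hm))
      (h2.mono fun m hm => by simpa [Nat.lt_succ_iff] using hm)
    simpa using this
  have hbdd : ∀ i, BddBelow (W i) := by
    intro i
    set M : ℝ := ∑ i, ∑ j, |w i j| with hM
    have hM0 : 0 ≤ M := Finset.sum_nonneg fun i _ => Finset.sum_nonneg fun j _ => abs_nonneg _
    refine ⟨-(L.card * M), ?_⟩
    rintro x ⟨k, f, -, h1, h2, -, rfl⟩
    have h3 : ∀ m ∈ Finset.range k, -M ≤ w (f m) (f (m + 1)) := fun m _ => by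
      have e1 : |w (f m) (f (m + 1))| ≤ ∑ j, |w (f m) j| :=
        Finset.single_le_sum (f := fun j => |w (f m) j|) (fun j _ => abs_nonneg _)
          (Finset.mem_univ _)
      have e2 : ∑ j, |w (f m) j| ≤ M :=
        Finset.single_le_sum (f := fun i => ∑ j, |w i j|)
          (fun i _ => Finset.sum_nonneg fun j _ => abs_nonneg _) (Finset.mem_univ _)
      linarith [neg_abs_le (w (f m) (f (m + 1)))]
    have h4 := Finset.card_nsmul_le_sum _ _ _ h3
    rw [Finset.card_range, nsmul_eq_mul] at h4
    have h5 : (k : ℝ) ≤ L.card := by exact_mod_cast (hlen k f h1 h2).trans' (Nat.le_succ k)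
    nlinarith
  refine ⟨fun i => sInf (W i), fun i hi j hj hij => ?_⟩
  have hne : (W j).Nonempty := ⟨0, 0, fun _ => j, rfl, fun _ _ => hj,
    fun a ha b hb _ => by simp at ha hb; omega, by simp, by simp⟩
  suffices H : sInf (W i) - w i j ≤ sInf (W j) by linarith
  refine le_csInf hne ?_
  rintro x ⟨k, f, hf0, hfL, hinj, hE, rfl⟩
  rw [sub_le_iff_le_add']
  set g : ℕ → Fin n := fun m => Nat.casesOn m i f with hg
  have hgsum : ∀ a, ∑ m ∈ Finset.range (a + 1), w (g m) (g (m + 1)) =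
      w i j + ∑ m ∈ Finset.range a, w (f m) (f (m + 1)) := by
    intro a
    rw [Finset.sum_range_succ', add_comm]
    simp [hg, hf0]
  have hgL : ∀ a ≤ k, ∀ m ≤ a + 1, g m ∈ L := by
    rintro a ha (_ | m) hm
    · exact hi
    · exact hfL m (by omega)
  have hgE : ∀ a ≤ k, ∀ m < a + 1, E (g m) (g (m + 1)) := by
    rintro a ha (_ | m) hm
    · simpa [hg, hf0] using hij
    · exact hE m (by omega)
  -- If prepending `i` creates a repetition, the closed part has nonnegative weight and can be
  -- dropped; what remains is again a walk from `i` without repetition.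
  by_cases hex : ∃ a ≤ k, f a = i
  · obtain ⟨a, ha, hfa⟩ := hex
    have hcyc := h (a + 1) (by omega) ((Nat.succ_le_succ ha).trans (hlen k f hfL hinj)) g
      (by simp [hg, hfa]) (hgL a ha) (hgE a ha)
    rw [hgsum] at hcyc
    have hsuf : ∑ m ∈ Finset.range (k - a), w (f (a + m)) (f (a + m + 1)) ∈ W i := by
      refine ⟨k - a, fun m => f (a + m), hfa, fun m hm => hfL _ (by omega), ?_,
        fun m hm => hE _ (by omega), rfl⟩
      intro x hx y hy hxy
      have := hinj (show a + x ∈ Set.Iic k by simp at hx ⊢; omega)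
        (show a + y ∈ Set.Iic k by simp at hy ⊢; omega) hxy
      omega
    have h1 := csInf_le (hbdd i) hsuf
    have h2 := Finset.sum_range_add (fun m => w (f m) (f (m + 1))) a (k - a)
    rw [Nat.add_sub_cancel' ha] at h2
    linarith
  · push Not at hex
    rw [← hgsum]
    refine csInf_le (hbdd i) ⟨k + 1, g, rfl, hgL k le_rfl, ?_, hgE k le_rfl, rfl⟩
    rintro (_ | x) hx (_ | y) hy hxy
    · rfl
    · exact absurd hxy.symm (hex y (by simp at hy; omega))
    · exact absurd hxy (hex x (by simp at hx; omega))
    · have := hinj (show x ∈ Set.Iic k by simp at hx ⊢; omega)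
        (show y ∈ Set.Iic k by simp at hy ⊢; omega) hxy
      omega

/-! ### Potentials and critical circuits -/

/-- The potential `U` bounds the arc weights of the `L × L` matrix `B`, reduced by `ρ`. -/
def IsPotential (L : Finset (Fin n)) (B : Matrix (Fin n) (Fin n) (WithTop ℝ)) (ρ : ℝ)
    (U : Fin n → ℝ) : Prop :=
  ∀ i ∈ L, ∀ j ∈ L, ∀ w : ℝ, B i j = w → U i + ρ ≤ w + U j

/-- The arcs of `L` for which the bound given by the potential is attained. -/
def Tight (L : Finset (Fin n)) (B : Matrix (Fin n) (Fin n) (WithTop ℝ)) (ρ : ℝ)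
    (U : Fin n → ℝ) (i j : Fin n) : Prop :=
  i ∈ L ∧ j ∈ L ∧ ∃ w : ℝ, B i j = w ∧ U i + ρ = w + U j

section Potential

variable {L : Finset (Fin n)} {B : Matrix (Fin n) (Fin n) (WithTop ℝ)} {ρ : ℝ} {U : Fin n → ℝ}

theorem exists_isPotential (h : rhoMin L B = ρ) : ∃ U, IsPotential L B ρ U := by
  obtain ⟨U, hU⟩ := exists_potential_of_closed_walks (L := L) (E := fun i j => B i j ≠ ⊤)
    (w := fun i j => (B i j).untopD 0 - ρ) (by
      intro k hk hkL f hf hfL hE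
      have h1 := rhoMin_le (B := B) hk hkL (c := fun m : Fin k => f m) fun m => hfL m m.2.le
      have h2 : circuitWeight B (fun m : Fin k => f m) =
          ((∑ m : Fin k, (B (f m) (f (m + 1))).untopD 0 : ℝ) : WithTop ℝ) :=
        circuitWeight_eq_coe fun m => by
          rw [walk_finRotate hf]
          obtain ⟨x, hx⟩ := WithTop.ne_top_iff_exists.1 (hE m m.2)
          rw [← hx]; rfl
      rw [h, circuitMean, h2, WithTop.map_coe, WithTop.coe_le_coe,
        le_div_iff₀ (by exact_mod_cast hk),
        Fin.sum_univ_eq_sum_range fun m => (B (f m) (f (m + 1))).untopD 0] at h1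
      rw [Finset.sum_sub_distrib, Finset.sum_const, Finset.card_range, nsmul_eq_mul]
      linarith)
  refine ⟨U, fun i hi j hj w hw => ?_⟩
  have := hU i hi j hj (by simp [hw])
  simp only [hw, WithTop.untopD_coe] at this
  linarith

/-- The potential telescopes around the circuit, so the excess of the weight over `k * ρ` is the sum
of the nonnegative slacks of the arcs. -/
theorem sum_le_circuit (hU : IsPotential L B ρ U) {k : ℕ} {c : Fin k → Fin n} (hc : ∀ m, c m ∈ L)
    {w : Fin k → ℝ} (hw : ∀ m, B (c m) (c (finRotate k m)) = w m) :
    k * ρ ≤ ∑ m, w m ∧ (∑ m, w m = k * ρ → ∀ m, Tight L B ρ U (c m) (c (finRotate k m))) := by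
  have hnn : ∀ m, 0 ≤ w m + U (c (finRotate k m)) - U (c m) - ρ := fun m => by
    linarith [hU _ (hc m) _ (hc (finRotate k m)) _ (hw m)]
  have hsum : ∑ m, (w m + U (c (finRotate k m)) - U (c m) - ρ) = ∑ m, w m - k * ρ := by
    simp only [Finset.sum_sub_distrib, Finset.sum_add_distrib]
    rw [Equiv.sum_comp (finRotate k) fun m => U (c m)]
    simp
  refine ⟨by linarith [Finset.sum_nonneg fun m (_ : m ∈ Finset.univ) => hnn m], fun h m => ?_⟩
  rw [h, sub_self] at hsum
  have := (Finset.sum_eq_zero_iff_of_nonneg fun m _ => hnn m).1 hsum m (Finset.mem_univ m)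
  exact ⟨hc _, hc _, w m, hw m, by linarith⟩

theorem IsCriticalCircuit.tight (hU : IsPotential L B ρ U) (hρ : rhoMin L B = ρ) {k : ℕ}
    {c : Fin k → Fin n} (h : IsCriticalCircuit L B c) (m : Fin k) :
    Tight L B ρ U (c m) (c (finRotate k m)) := by
  obtain ⟨hk, hc, -, h1⟩ := h
  rw [hρ, circuitMean_eq_coe hk] at h1
  obtain ⟨w, hw, hs⟩ := exists_arc_weights h1
  exact (sum_le_circuit hU hc hw).2 hs m

theorem isCriticalCircuit_of_tight_walk (hρ : rhoMin L B = ρ) {k : ℕ} (hk : 0 < k) {f : ℕ → Fin n}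
    (hf : f k = f 0) (h : ∀ m < k, Tight L B ρ U (f m) (f (m + 1))) :
    IsCriticalCircuit L B fun m : Fin k => f m := by
  have h' : ∀ m : Fin k, Tight L B ρ U (f m) (f (finRotate k m)) := fun m => by
    rw [walk_finRotate hf]; exact h m m.2
  choose h1 h2 w hw hwU using h'
  refine ⟨hk, h1, fun m => (hw m).trans_ne WithTop.coe_ne_top, ?_⟩
  rw [hρ, circuitMean_eq_coe hk, circuitWeight_eq_coe hw, WithTop.coe_inj]
  have : ∑ m, w m = ∑ m : Fin k, (U (f m) + ρ - U (f (finRotate k m))) :=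
    Finset.sum_congr rfl fun m _ => by linarith [hwU m]
  rw [this]
  simp only [Finset.sum_sub_distrib, Finset.sum_add_distrib]
  rw [Equiv.sum_comp (finRotate k) fun m : Fin k => U (f m)]
  simp

/-- For any potential, the critical circuits are exactly the closed walks of tight arcs. -/
theorem mem_criticalNodes_iff (hU : IsPotential L B ρ U) (hρ : rhoMin L B = ρ) {i : Fin n} :
    i ∈ criticalNodes L B ↔ TransGen (Tight L B ρ U) i i := by
  classical
  simp only [criticalNodes, Finset.mem_filter]
  constructor
  · rintro ⟨-, k, c, hc, m, rfl⟩
    have ht := hc.tight hU hρ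
    refine TransGen.head' (ht m) ?_
    have := reflTransGen_of_perm (R := fun a b => Tight L B ρ U (c a) (c b)) (finRotate k)
      (fun x => .single (ht x)) m
    exact ReflTransGen.lift c (fun _ _ h => h) _ _ this
  · intro h
    obtain ⟨k, hk, f, h0, hfk, hf⟩ := exists_walk_of_transGen h
    refine ⟨h0 ▸ (hf 0 hk).1, k, _, isCriticalCircuit_of_tight_walk hρ hk (hfk.trans h0.symm) hf,
      ⟨0, hk⟩, h0⟩

theorem criticalGraph_iff (hU : IsPotential L B ρ U) (hρ : rhoMin L B = ρ) {i j : Fin n} :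
    criticalGraph L B i j ↔ Tight L B ρ U i j ∧ ReflTransGen (Tight L B ρ U) j i := by
  constructor
  · rintro ⟨k, c, hc, m, rfl, rfl⟩
    have ht := hc.tight hU hρ
    refine ⟨ht m, ?_⟩
    have := reflTransGen_of_perm (R := fun a b => Tight L B ρ U (c a) (c b)) (finRotate k)
      (fun x => .single (ht x)) m
    exact ReflTransGen.lift c (fun _ _ h => h) _ _ this
  · rintro ⟨h1, h2⟩
    rcases reflTransGen_iff_eq_or_transGen.1 h2 with rfl | h2
    · exact ⟨1, _, isCriticalCircuit_of_tight_walk (f := fun _ => i) hρ one_pos rfl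
        (fun _ _ => h1), 0, rfl, rfl⟩
    · obtain ⟨k, hk, f, h0, hfk, hf⟩ := exists_walk_of_transGen h2
      set g : ℕ → Fin n := fun m => Nat.casesOn m i f with hg
      have hgk : g (k + 1) = g 0 := hfk
      refine ⟨k + 1, _, isCriticalCircuit_of_tight_walk (U := U) (f := g) hρ (by omega) hgk ?_,
        ⟨0, by omega⟩, rfl, ?_⟩
      · rintro (_ | m) hm
        · simpa [hg, h0] using h1
        · exact hf m (by omega)
      · rw [walk_finRotate hgk]
        exact h0

theorem criticalNodes_nonempty (hρ : rhoMin L B = ρ) : (criticalNodes L B).Nonempty := by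
  classical
  obtain ⟨k, hk, -, c, hc, w, hw, hs⟩ := exists_circuit_eq_rhoMin hρ
  refine ⟨c ⟨0, hk⟩, Finset.mem_filter.2 ⟨hc _, k, c, ⟨hk, hc, fun m => (hw m).trans_ne WithTop.coe_ne_top, ?_⟩, _, rfl⟩⟩
  rw [hρ, circuitMean_eq_coe hk, circuitWeight_eq_coe hw, hs]

theorem criticalNodes_subset : criticalNodes L B ⊆ L := by
  classical
  exact Finset.filter_subset _ _

/-- There are finitely many arcs. The uniform gap is what survives the infimum over walks of all
lengths in a Kleene star. -/
theorem exists_gap (hU : IsPotential L B ρ U) : ∃ δ > 0, ∀ i ∈ L, ∀ j ∈ L, ∀ w : ℝ, B i j = w →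
    Tight L B ρ U i j ∨ U i + ρ + δ ≤ w + U j := by
  have : ∀ᶠ δ in 𝓝[>] (0 : ℝ), ∀ i j, i ∈ L → j ∈ L → ∀ w : ℝ, B i j = w →
      Tight L B ρ U i j ∨ U i + ρ + δ ≤ w + U j := by
    refine eventually_all.2 fun i => eventually_all.2 fun j => ?_
    by_cases h : ∃ w : ℝ, i ∈ L ∧ j ∈ L ∧ B i j = w ∧ U i + ρ < w + U j
    · obtain ⟨w, hi, hj, hw, hlt⟩ := h
      filter_upwards [Ioo_mem_nhdsGT (sub_pos.2 hlt)] with δ hδ _ _ w' hw'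
      have : w = w' := WithTop.coe_inj.1 (hw.symm.trans hw')
      subst this
      exact Or.inr (by linarith [hδ.2])
    · refine Eventually.of_forall fun δ hi hj w hw => Or.inl ⟨hi, hj, w, hw, ?_⟩
      push Not at h
      exact le_antisymm (hU i hi j hj w hw) (h w hi hj hw)
  obtain ⟨δ, h1, h2⟩ := (this.and self_mem_nhdsWithin).exists
  exact ⟨δ, h2, fun i hi j hj => h1 i j hi hj⟩

end Potential

/-! ### Kleene stars and min-plus Schur complements -/

theorem add_inf_eq {ι : Type*} (b : WithTop ℝ) (s : Finset ι) (f : ι → WithTop ℝ) :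
    b + s.inf f = s.inf fun i => b + f i :=
  Finset.apply_inf_eq_inf_comp_of_linearOrder (fun x => b + x)
    (fun _ _ h => add_le_add_right h b) (WithTop.add_top b)

theorem neg_coe_add_le_iff {c : ℝ} {x y : WithTop ℝ} :
    ((-c : ℝ) : WithTop ℝ) + x ≤ y ↔ x ≤ (c : WithTop ℝ) + y := by
  induction x using WithTop.recTopCoe with
  | top => induction y using WithTop.recTopCoe with
    | top => simp
    | coe y =>
      rw [WithTop.add_top, ← WithTop.coe_add]
      simp
  | coe x => induction y using WithTop.recTopCoe with
    | top => simp
    | coe y =>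
      rw [← WithTop.coe_add, ← WithTop.coe_add, WithTop.coe_le_coe, WithTop.coe_le_coe]
      constructor <;> intro h <;> linarith

section Star

variable {C : Finset (Fin n)} {b : Matrix (Fin n) (Fin n) (WithTop ℝ)}

/-- `mpow` grows at its last arc; this bound extends a walk at its first arc. -/
theorem mpow_succ_le (m : ℕ) {p p' q : Fin n} (hp : p ∈ C) :
    mpow C b (m + 1) p q ≤ b p p' + mpow C b m p' q := by
  induction m generalizing q with
  | zero =>
    by_cases h : p' = q
    · subst h
      refine (Finset.inf_le hp).trans ?_
      simp [mpow]
    · simp [mpow, h]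
  | succ m ih =>
    change C.inf _ ≤ b p p' + C.inf _
    rw [add_inf_eq]
    refine Finset.inf_mono_fun fun r _ => ?_
    rw [← add_assoc]
    exact add_le_add_left ih _

theorem kleeneStar_le (hb : ∀ p ∈ C, ∀ q ∈ C, BddBelow (Set.range fun m => mpow C b m p q))
    {p q : Fin n} (hp : p ∈ C) (hq : q ∈ C) (m : ℕ) : kleeneStar C b p q ≤ mpow C b m p q :=
  ciInf_le (hb p hp q hq) m

theorem kleeneStar_le_add (hb : ∀ p ∈ C, ∀ q ∈ C, BddBelow (Set.range fun m => mpow C b m p q))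
    {p p' q : Fin n} (hp : p ∈ C) (hq : q ∈ C) :
    kleeneStar C b p q ≤ b p p' + kleeneStar C b p' q := by
  cases hx : b p p' using WithTop.recTopCoe with
  | top => simp
  | coe x =>
    rw [← neg_coe_add_le_iff]
    refine le_ciInf fun m => ?_
    rw [neg_coe_add_le_iff, ← hx]
    exact (kleeneStar_le hb hp hq (m + 1)).trans (mpow_succ_le m hp)

end Star

section Schur

variable {L C : Finset (Fin n)} {B : Matrix (Fin n) (Fin n) (WithTop ℝ)} {ρ δ : ℝ} {U : Fin n → ℝ}

/-- The matrix `B` reduced by `ρ`. -/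
def reduced (ρ : ℝ) (B : Matrix (Fin n) (Fin n) (WithTop ℝ)) : Matrix (Fin n) (Fin n) (WithTop ℝ) :=
  fun u v => ((-ρ : ℝ) : WithTop ℝ) + B u v

/-- Slacks add up along a walk: either all its arcs are tight, or one of them already contributes
`δ`. -/
theorem mpow_reduced_cases (hU : IsPotential L B ρ U)
    (hgap : ∀ i ∈ L, ∀ j ∈ L, ∀ w : ℝ, B i j = w → Tight L B ρ U i j ∨ U i + ρ + δ ≤ w + U j)
    (hC : C ⊆ L) (m : ℕ) {p q : Fin n} (hq : q ∈ C) {w : ℝ}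
    (hw : mpow C (reduced ρ B) m p q = w) :
    U p ≤ w + U q ∧ (ReflTransGen (Tight L B ρ U) p q ∨ U p + δ ≤ w + U q) := by
  induction m generalizing q w with
  | zero =>
    simp only [mpow] at hw
    split_ifs at hw with h
    · subst h
      have : (0 : ℝ) = w := WithTop.coe_inj.1 hw
      subst this
      exact ⟨by simp, Or.inl .refl⟩
    · exact absurd hw WithTop.top_ne_coe
  | succ m ih =>
    obtain ⟨r, hr, h1⟩ := exists_eq_of_inf_eq_coe hw
    obtain ⟨w₁, w₂, h2, h3, rfl⟩ := WithTop.add_eq_coe.1 h1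
    obtain ⟨x, w₃, h4, h5, rfl⟩ := WithTop.add_eq_coe.1 h3.symm
    rw [WithTop.coe_inj] at h4
    subst h4
    obtain ⟨h6, h7⟩ := ih hr h2.symm
    have h8 := hU r (hC hr) q (hC hq) _ h5.symm
    refine ⟨by linarith, ?_⟩
    rcases h7 with h7 | h7
    · rcases hgap r (hC hr) q (hC hq) _ h5.symm with h9 | h9
      · exact Or.inl (h7.tail h9)
      · exact Or.inr (by linarith)
    · exact Or.inr (by linarith)

theorem bddBelow_mpow_reduced (hU : IsPotential L B ρ U) (hC : C ⊆ L) :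
    ∀ p ∈ C, ∀ q ∈ C, BddBelow (Set.range fun m => mpow C (reduced ρ B) m p q) := by
  intro p _ q hq
  refine ⟨((U p - U q : ℝ) : WithTop ℝ), ?_⟩
  rintro _ ⟨m, rfl⟩
  change _ ≤ mpow C (reduced ρ B) m p q
  cases hx : mpow C (reduced ρ B) m p q using WithTop.recTopCoe with
  | top => exact le_top
  | coe x =>
    -- For `δ = 0` the gap hypothesis is the potential inequality itself.
    have := (mpow_reduced_cases (δ := 0) hU (fun i hi j hj w hw => Or.inr (by
      simpa using hU i hi j hj w hw)) hC m hq hx).1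
    rw [WithTop.coe_le_coe]
    linarith

/-- The infimum is approximated by powers within any `e > 0`, so it need not be known to be
attained: `δ` does not depend on the power. -/
theorem kleeneStar_reduced_cases (hU : IsPotential L B ρ U)
    (hgap : ∀ i ∈ L, ∀ j ∈ L, ∀ w : ℝ, B i j = w → Tight L B ρ U i j ∨ U i + ρ + δ ≤ w + U j)
    (hC : C ⊆ L) {p q : Fin n} (hq : q ∈ C) {w : ℝ}
    (hw : kleeneStar C (reduced ρ B) p q = w) :
    U p ≤ w + U q ∧ (ReflTransGen (Tight L B ρ U) p q ∨ U p + δ ≤ w + U q) := by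
  have key : ∀ e > 0, ∃ w' < w + e,
      U p ≤ w' + U q ∧ (ReflTransGen (Tight L B ρ U) p q ∨ U p + δ ≤ w' + U q) := by
    intro e he
    have hlt : kleeneStar C (reduced ρ B) p q < ((w + e : ℝ) : WithTop ℝ) := by
      rw [hw, WithTop.coe_lt_coe]; linarith
    obtain ⟨m, hm⟩ := exists_lt_of_ciInf_lt hlt
    obtain ⟨w', hw'⟩ := WithTop.ne_top_iff_exists.1 hm.ne_top
    rw [← hw', WithTop.coe_lt_coe] at hm
    exact ⟨w', hm, mpow_reduced_cases hU hgap hC m hq hw'.symm⟩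
  constructor
  · refine le_of_forall_pos_le_add fun e he => ?_
    obtain ⟨w', h1, h2, -⟩ := key e he
    linarith
  · by_cases hT : ReflTransGen (Tight L B ρ U) p q
    · exact Or.inl hT
    · refine Or.inr (le_of_forall_pos_le_add fun e he => ?_)
      obtain ⟨w', h1, -, h2⟩ := key e he
      have := h2.resolve_left hT
      linarith

theorem mpSchur_cases (hU : IsPotential L B ρ U)
    (hgap : ∀ i ∈ L, ∀ j ∈ L, ∀ w : ℝ, B i j = w → Tight L B ρ U i j ∨ U i + ρ + δ ≤ w + U j)
    (hC : C ⊆ L) {i j : Fin n} (hi : i ∈ L) (hj : j ∈ L) {w : ℝ}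
    (hw : mpSchur C ρ B i j = w) :
    U i + ρ ≤ w + U j ∧ (TransGen (Tight L B ρ U) i j ∨ U i + ρ + δ ≤ w + U j) := by
  rcases min_choice (B i j) (C.inf fun p => C.inf fun q =>
    B i p + kleeneStar C (reduced ρ B) p q + ((-ρ : ℝ) : WithTop ℝ) + B q j) with h | h
  · have hB : B i j = w := h.symm.trans hw
    exact ⟨hU i hi j hj w hB, (hgap i hi j hj w hB).imp_left .single⟩
  · obtain ⟨p, hp, h1⟩ := exists_eq_of_inf_eq_coe (h.symm.trans hw)
    obtain ⟨q, hq, h2⟩ := exists_eq_of_inf_eq_coe h1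
    obtain ⟨x, w₃, h3, h4, rfl⟩ := WithTop.add_eq_coe.1 h2
    obtain ⟨y, r, h5, h6, rfl⟩ := WithTop.add_eq_coe.1 h3.symm
    rw [WithTop.coe_inj] at h6
    subst h6
    obtain ⟨w₁, w₂, h7, h8, rfl⟩ := WithTop.add_eq_coe.1 h5.symm
    obtain ⟨e1, e2⟩ := kleeneStar_reduced_cases hU hgap hC hq h8.symm
    have e3 := hU i hi p (hC hp) _ h7.symm
    have e4 := hU q (hC hq) j hj _ h4.symm
    refine ⟨by linarith, ?_⟩
    rcases e2 with e2 | e2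
    · rcases hgap i hi p (hC hp) _ h7.symm with e5 | e5
      · rcases hgap q (hC hq) j hj _ h4.symm with e6 | e6
        · exact Or.inl (TransGen.head' e5 (e2.tail e6))
        · exact Or.inr (by linarith)
      · exact Or.inr (by linarith)
    · exact Or.inr (by linarith)

/-- The minimal circuit mean strictly increases when the critical nodes are eliminated. -/
theorem lt_rhoMin_mpSchur (hρ : rhoMin L B = ρ) {ρ' : ℝ}
    (hρ' : rhoMin (L \ criticalNodes L B) (mpSchur (criticalNodes L B) ρ B) = ρ') : ρ < ρ' := by
  obtain ⟨U, hU⟩ := exists_isPotential hρ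
  obtain ⟨δ, hδ, hgap⟩ := exists_gap hU
  obtain ⟨k, hk, -, c, hc, w, hw, hs⟩ := exists_circuit_eq_rhoMin hρ'
  have hcL : ∀ m, c m ∈ L := fun m => (Finset.mem_sdiff.1 (hc m)).1
  have hcase := fun m => mpSchur_cases hU hgap criticalNodes_subset (hcL m)
    (hcL (finRotate k m)) (hw m)
  -- Otherwise every arc of the circuit expands to a walk of tight arcs in `L`, and together they
  -- form a tight closed walk. Its node `c 0` would be critical, although it was not eliminated.
  have hex : ∃ m, U (c m) + ρ + δ ≤ w m + U (c (finRotate k m)) := by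
    by_contra hcon
    push Not at hcon
    have hT : ∀ m, TransGen (Tight L B ρ U) (c m) (c (finRotate k m)) := fun m =>
      (hcase m).2.resolve_right (not_le.2 (hcon m))
    have h1 := reflTransGen_of_perm (R := fun a b => TransGen (Tight L B ρ U) (c a) (c b))
      (finRotate k) (fun x => .single (hT x)) ⟨0, hk⟩
    have h2 : ReflTransGen (TransGen (Tight L B ρ U)) (c (finRotate k ⟨0, hk⟩)) (c ⟨0, hk⟩) :=
      ReflTransGen.lift c (fun _ _ h => h) _ _ h1
    have h3 := TransGen.head' (hT ⟨0, hk⟩) h2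
    rw [transGen_eq_self] at h3
    exact (Finset.mem_sdiff.1 (hc ⟨0, hk⟩)).2 ((mem_criticalNodes_iff hU hρ).2 h3)
  have hlt : ∑ m, (U (c m) + ρ) < ∑ m, (w m + U (c (finRotate k m))) := by
    obtain ⟨m, hm⟩ := hex
    exact Finset.sum_lt_sum (fun m _ => (hcase m).1) ⟨m, Finset.mem_univ _, by linarith⟩
  rw [Finset.sum_add_distrib, Finset.sum_add_distrib,
    Equiv.sum_comp (finRotate k) fun m => U (c m), hs, Finset.sum_const, Finset.card_univ,
    Fintype.card_fin, nsmul_eq_mul] at hlt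
  have hk' : (0 : ℝ) < k := by exact_mod_cast hk
  nlinarith

/-! ### Irreducibility -/

/-- Any two nodes of `L` are joined by a path in `L`. -/
def IrreducibleOn (L : Finset (Fin n)) (B : Matrix (Fin n) (Fin n) (WithTop ℝ)) : Prop :=
  ∀ i ∈ L, ∀ j ∈ L, TransGen (fun p q => p ∈ L ∧ q ∈ L ∧ B p q ≠ ⊤) i j

theorem IrreducibleOn.exists_rhoMin_eq (h : IrreducibleOn L B) (hL : L.Nonempty) :
    ∃ ρ : ℝ, rhoMin L B = ρ := by
  have := rhoMin_ne_top (B := B) hL fun i hi => by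
    obtain ⟨j, hj, -⟩ := TransGen.head'_iff.1 (h i hi i hi)
    exact ⟨j, hj.2⟩
  obtain ⟨ρ, hρ⟩ := WithTop.ne_top_iff_exists.1 this
  exact ⟨ρ, hρ.symm⟩

theorem mpSchur_le_arc {i j : Fin n} : mpSchur C ρ B i j ≤ B i j := inf_le_left

theorem mpSchur_le_path {i j p q : Fin n} (hp : p ∈ C) (hq : q ∈ C) :
    mpSchur C ρ B i j ≤
      B i p + kleeneStar C (reduced ρ B) p q + ((-ρ : ℝ) : WithTop ℝ) + B q j :=
  inf_le_right.trans ((Finset.inf_le hp).trans (Finset.inf_le hq))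

/-- A path in `L` splits into arcs outside `C` and excursions through `C`; each excursion is
shortcut by one arc of the Schur complement. -/
theorem IrreducibleOn.mpSchur (h : IrreducibleOn L B) (hU : IsPotential L B ρ U) (hC : C ⊆ L) :
    IrreducibleOn (L \ C) (mpSchur C ρ B) := by
  set N := L \ C with hN
  have hbdd := bddBelow_mpow_reduced hU hC
  -- When the path currently ends in `C`, the induction remembers the unfinished excursion: its exit
  -- node `i'`, its entry `p` into `C`, and a walk in `C` from `p` to `x`.
  have key : ∀ i ∈ N, ∀ x, TransGen (fun p q => p ∈ L ∧ q ∈ L ∧ B p q ≠ ⊤) i x →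
      (x ∈ N → TransGen (fun p q => p ∈ N ∧ q ∈ N ∧ MinPlus.mpSchur C ρ B p q ≠ ⊤) i x) ∧
      (x ∈ C → ∃ i' ∈ N, ReflTransGen
        (fun p q => p ∈ N ∧ q ∈ N ∧ MinPlus.mpSchur C ρ B p q ≠ ⊤) i i' ∧
        ∃ p ∈ C, B i' p ≠ ⊤ ∧ ∃ m, mpow C (reduced ρ B) m p x ≠ ⊤) := by
    intro i hi x hx
    have step : ∀ y z, y ∈ N → ReflTransGen
        (fun p q => p ∈ N ∧ q ∈ N ∧ MinPlus.mpSchur C ρ B p q ≠ ⊤) i y → B y z ≠ ⊤ →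
        (z ∈ N → TransGen (fun p q => p ∈ N ∧ q ∈ N ∧ MinPlus.mpSchur C ρ B p q ≠ ⊤) i z) ∧
        (z ∈ C → ∃ i' ∈ N, ReflTransGen
          (fun p q => p ∈ N ∧ q ∈ N ∧ MinPlus.mpSchur C ρ B p q ≠ ⊤) i i' ∧
          ∃ p ∈ C, B i' p ≠ ⊤ ∧ ∃ m, mpow C (reduced ρ B) m p z ≠ ⊤) := by
      intro y z hy hiy hyz
      exact ⟨fun hz => TransGen.tail' hiy ⟨hy, hz, ne_top_of_le_ne_top hyz mpSchur_le_arc⟩,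
        fun hz => ⟨y, hy, hiy, z, hz, hyz, 0, by simp [mpow]⟩⟩
    induction hx with
    | single h1 => exact step _ _ hi .refl h1.2.2
    | @tail y z _ h1 ih =>
      by_cases hyC : y ∈ C
      · obtain ⟨i', hi', hii', p, hp, hip, m, hm⟩ := ih.2 hyC
        refine ⟨fun hz => TransGen.tail' hii' ⟨hi', hz, ?_⟩, fun hz =>
          ⟨i', hi', hii', p, hp, hip, m + 1, ?_⟩⟩
        · refine ne_top_of_le_ne_top ?_ (mpSchur_le_path hp hyC)
          have hs := ne_top_of_le_ne_top hm (kleeneStar_le hbdd hp hyC m)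
          simp [hip, hs, h1.2.2]
        · have hle : mpow C (reduced ρ B) (m + 1) p z ≤
              mpow C (reduced ρ B) m p y + reduced ρ B y z := Finset.inf_le hyC
          refine ne_top_of_le_ne_top ?_ hle
          simp [reduced, hm, h1.2.2]
      · have hyN : y ∈ N := Finset.mem_sdiff.2 ⟨h1.1, hyC⟩
        exact step _ _ hyN (ih.1 hyN).to_reflTransGen h1.2.2
  exact fun i hi j hj => (key i hi j (h i (Finset.mem_sdiff.1 hi).1 j (Finset.mem_sdiff.1 hj).1)).1 hj

/-! ### Extending potentials -/

/-- `V` is a subeigenvector for the eigenvalue `0` of the `L × L` matrix `D⁻¹ B`, where `D` is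
diagonal with entries `d`. -/
def IsSubeigenvector (L : Finset (Fin n)) (B : Matrix (Fin n) (Fin n) (WithTop ℝ)) (d : Fin n → ℝ)
    (V : Fin n → WithTop ℝ) : Prop :=
  ∀ i ∈ L, ∀ j ∈ L, V i ≤ ((-d i : ℝ) : WithTop ℝ) + B i j + V j

theorem IsPotential.isSubeigenvector (hU : IsPotential L B ρ U) {d : Fin n → ℝ}
    (hd : ∀ i ∈ L, d i = ρ) : IsSubeigenvector L B d fun i => U i := by
  intro i hi j hj
  rw [hd i hi]
  cases hx : B i j using WithTop.recTopCoe with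
  | top => simp
  | coe x =>
    have := hU i hi j hj x hx
    rw [← WithTop.coe_add, ← WithTop.coe_add, WithTop.coe_le_coe]
    linarith

/-- On `C` the extension is `(ρ⁻¹ B_CC)^* ρ⁻¹ B_CN V` in min-plus notation. The rows in `C` follow
from the star inequality, the other rows from the hypothesis on the Schur complement. -/
theorem IsSubeigenvector.extend (hU : IsPotential L B ρ U) (hC : C ⊆ L) {d : Fin n → ℝ}
    (hd : ∀ i ∈ C, d i = ρ) {V : Fin n → WithTop ℝ}
    (hV : IsSubeigenvector (L \ C) (mpSchur C ρ B) d V) :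
    ∃ V', IsSubeigenvector L B d V' ∧ ∀ i ∈ L \ C, V' i = V i := by
  set E : Fin n → WithTop ℝ := fun p => C.inf fun q => (L \ C).inf fun j =>
    kleeneStar C (reduced ρ B) p q + (((-ρ : ℝ) : WithTop ℝ) + B q j + V j) with hE
  have hbdd := bddBelow_mpow_reduced hU hC
  have hN : ∀ i ∈ L \ C, i ∉ C := fun i hi => (Finset.mem_sdiff.1 hi).2
  refine ⟨fun i => if i ∈ C then E i else V i, fun i hi j hj => ?_, fun i hi => if_neg (hN i hi)⟩
  change (if i ∈ C then E i else V i) ≤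
    ((-d i : ℝ) : WithTop ℝ) + B i j + (if j ∈ C then E j else V j)
  by_cases hiC : i ∈ C
  · rw [if_pos hiC, hd i hiC]
    by_cases hjC : j ∈ C
    · rw [if_pos hjC]
      simp only [hE, add_inf_eq]
      refine Finset.inf_mono_fun fun q hq => Finset.inf_mono_fun fun l _ => ?_
      exact (add_le_add_left (kleeneStar_le_add hbdd hiC hq) _).trans_eq (add_assoc _ _ _)
    · rw [if_neg hjC]
      refine (Finset.inf_le hiC).trans ((Finset.inf_le (Finset.mem_sdiff.2 ⟨hj, hjC⟩)).trans ?_)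
      have h0 : kleeneStar C (reduced ρ B) i i ≤ 0 :=
        (kleeneStar_le hbdd hiC hiC 0).trans (by simp [mpow])
      exact (add_le_add_left h0 _).trans (by rw [zero_add])
  · have hiN := Finset.mem_sdiff.2 ⟨hi, hiC⟩
    rw [if_neg hiC]
    by_cases hjC : j ∈ C
    · rw [if_pos hjC]
      simp only [hE, add_inf_eq]
      refine Finset.le_inf fun q hq => Finset.le_inf fun l hl => ?_
      refine (hV i hiN l hl).trans ?_
      calc _ ≤ ((-d i : ℝ) : WithTop ℝ) + (B i j + kleeneStar C (reduced ρ B) j q +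
            ((-ρ : ℝ) : WithTop ℝ) + B q l) + V l :=
            add_le_add_left (add_le_add_right (mpSchur_le_path hjC hq) _) _
        _ = _ := by abel
    · rw [if_neg hjC]
      exact (hV i hiN j (Finset.mem_sdiff.2 ⟨hj, hjC⟩)).trans
        (add_le_add_left (add_le_add_right mpSchur_le_arc _) _)

end Schur

/-! ### The stages of the elimination -/

section Stages

variable {A : Matrix (Fin n) (Fin n) (WithTop ℝ)}

theorem nodesFrom_succ (ℓ : ℕ) : nodesFrom A (ℓ + 1) = nodesFrom A ℓ \ critClass A ℓ := rfl

theorem stage_succ_snd (ℓ : ℕ) :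
    (stage A (ℓ + 1)).2 = mpSchur (critClass A ℓ) (alpha A ℓ) (stage A ℓ).2 := rfl

theorem nodesFrom_anti : Antitone (nodesFrom A) :=
  antitone_nat_of_succ_le fun ℓ => by rw [nodesFrom_succ]; exact Finset.sdiff_subset

theorem irreducibleOn_stage (hA : Irreducible A) (ℓ : ℕ) :
    IrreducibleOn (nodesFrom A ℓ) (stage A ℓ).2 := by
  induction ℓ with
  | zero =>
    intro i _ j _
    exact TransGen.mono (fun p q h => ⟨Finset.mem_univ _, Finset.mem_univ _, h⟩) _ _ (hA i j)
  | succ ℓ ih =>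
    rcases (nodesFrom A ℓ).eq_empty_or_nonempty with h | h
    · intro i hi
      rw [nodesFrom_succ, h] at hi
      simp at hi
    · obtain ⟨ρ, hρ⟩ := ih.exists_rhoMin_eq h
      obtain ⟨U, hU⟩ := exists_isPotential hρ
      have := ih.mpSchur hU (criticalNodes_subset (B := (stage A ℓ).2))
      rw [nodesFrom_succ, stage_succ_snd, show alpha A ℓ = ρ from congrArg (WithTop.untopD 0) hρ]
      exact this

/-- Irreducibility is inherited by every stage, so the default value of `untopD` in `alpha` is never
used while nodes remain. -/
theorem rhoMin_stage (hA : Irreducible A) {ℓ : ℕ} (h : (nodesFrom A ℓ).Nonempty) :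
    rhoMin (nodesFrom A ℓ) (stage A ℓ).2 = alpha A ℓ := by
  obtain ⟨ρ, hρ⟩ := (irreducibleOn_stage hA ℓ).exists_rhoMin_eq h
  change _ = (((rhoMin (nodesFrom A ℓ) (stage A ℓ).2).untopD 0 : ℝ) : WithTop ℝ)
  rw [hρ]; rfl

theorem nodesFrom_numCrit (hA : Irreducible A) : nodesFrom A (numCrit A) = ∅ := by
  -- Each nonempty stage removes at least one critical node, so the elimination ends and the infimum
  -- defining `numCrit` is attained.
  have key : ∀ ℓ, nodesFrom A ℓ = ∅ ∨ (nodesFrom A ℓ).card + ℓ ≤ n := by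
    intro ℓ
    induction ℓ with
    | zero => exact Or.inr (by simpa using Finset.card_le_univ (nodesFrom A 0))
    | succ ℓ ih =>
      rcases (nodesFrom A ℓ).eq_empty_or_nonempty with h | h
      · exact Or.inl (Finset.subset_empty.1 (h ▸ nodesFrom_anti ℓ.le_succ))
      · have h1 := ih.resolve_left h.ne_empty
        have h2 : (critClass A ℓ).Nonempty := criticalNodes_nonempty (rhoMin_stage hA h)
        have h3 := Finset.card_sdiff_of_subset (critClass_subset A ℓ)
        have h4 := h2.card_pos
        have h5 := Finset.card_le_card (critClass_subset A ℓ)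
        refine Or.inr ?_
        rw [nodesFrom_succ, h3]
        omega
  refine Nat.sInf_mem (s := {ℓ | nodesFrom A ℓ = ∅}) ⟨n + 1, ?_⟩
  exact (key (n + 1)).resolve_right (by omega)

theorem nodesFrom_nonempty {ℓ : ℕ} (h : ℓ < numCrit A) : (nodesFrom A ℓ).Nonempty :=
  Finset.nonempty_iff_ne_empty.2 (Nat.notMem_of_lt_sInf h)

theorem alpha_lt_alpha_succ (hA : Irreducible A) {ℓ : ℕ} (hℓ : ℓ + 1 < numCrit A) :
    alpha A ℓ < alpha A (ℓ + 1) := by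
  have h := rhoMin_stage hA (nodesFrom_nonempty hℓ)
  rw [nodesFrom_succ, stage_succ_snd] at h
  exact lt_rhoMin_mpSchur (rhoMin_stage hA (nodesFrom_nonempty (ℓ.lt_succ_self.trans hℓ))) h

theorem alpha_lt_alpha (hA : Irreducible A) {m ℓ : ℕ} (hm : m < ℓ) (hℓ : ℓ < numCrit A) :
    alpha A m < alpha A ℓ := by
  induction ℓ, Nat.succ_le_of_lt hm using Nat.le_induction with
  | base => exact alpha_lt_alpha_succ hA hℓ
  | succ ℓ h ih => exact (ih (by omega) (by omega)).trans (alpha_lt_alpha_succ hA hℓ)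

theorem nodesBefore_succ (ℓ : ℕ) : nodesBefore A (ℓ + 1) = nodesBefore A ℓ ∪ critClass A ℓ := by
  rw [nodesBefore, Finset.range_add_one, Finset.biUnion_insert, Finset.union_comm]
  rfl

theorem mem_nodesBefore_iff {ℓ : ℕ} {i : Fin n} : i ∈ nodesBefore A ℓ ↔ i ∉ nodesFrom A ℓ := by
  induction ℓ with
  | zero => simp [nodesBefore, nodesFrom, stage]
  | succ ℓ ih =>
    rw [nodesBefore_succ, nodesFrom_succ, Finset.mem_union, Finset.mem_sdiff, ih]
    tauto

theorem disjoint_nodesBefore_critClass (ℓ : ℕ) : Disjoint (nodesBefore A ℓ) (critClass A ℓ) :=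
  Finset.disjoint_left.2 fun _ h1 h2 => mem_nodesBefore_iff.1 h1 (critClass_subset A ℓ h2)

theorem card_nodesFrom_add (ℓ : ℕ) : (nodesFrom A ℓ).card + (nodesBefore A ℓ).card = n := by
  have h : nodesBefore A ℓ = (nodesFrom A ℓ)ᶜ := by
    ext i
    rw [mem_nodesBefore_iff, Finset.mem_compl]
  rw [h, Finset.card_add_card_compl, Fintype.card_fin]

theorem exists_mem_critClass (hA : Irreducible A) {m : ℕ} {i : Fin n} (hi : i ∈ nodesFrom A m) :
    ∃ ℓ, m ≤ ℓ ∧ ℓ < numCrit A ∧ i ∈ critClass A ℓ := by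
  by_contra hcon
  push Not at hcon
  have hm : m ≤ numCrit A := by
    by_contra h
    have := nodesFrom_anti (A := A) (not_le.1 h).le hi
    simp [nodesFrom_numCrit hA] at this
  have key : ∀ ℓ, m ≤ ℓ → ℓ ≤ numCrit A → i ∈ nodesFrom A ℓ := by
    intro ℓ hℓ
    induction ℓ, hℓ using Nat.le_induction with
    | base => exact fun _ => hi
    | succ ℓ h ih =>
      intro h1
      rw [nodesFrom_succ, Finset.mem_sdiff]
      exact ⟨ih (by omega), hcon ℓ h (by omega)⟩
  have := key _ hm le_rfl
  simp [nodesFrom_numCrit hA] at this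

/-- The diagonal entries of the matrix `D` of the last stage. -/
noncomputable def lastDiag (A : Matrix (Fin n) (Fin n) (WithTop ℝ)) : Fin n → ℝ := dDiag A (numCrit A - 1)

theorem dDiag_eq {ℓ m : ℕ} (hm : m ≤ ℓ) {i : Fin n} (hi : i ∈ critClass A m) :
    dDiag A ℓ i = alpha A m := by
  induction ℓ, hm using Nat.le_induction with
  | base =>
    cases m with
    | zero => rfl
    | succ m => exact if_pos (critClass_subset A _ hi)
  | succ ℓ h ih =>
    refine (if_neg fun h1 => ?_).trans ih
    have := nodesFrom_anti (A := A) (Nat.succ_le_succ h) h1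
    rw [nodesFrom_succ, Finset.mem_sdiff] at this
    exact this.2 hi

theorem lastDiag_eq {ℓ : ℕ} (hℓ : ℓ < numCrit A) {i : Fin n} (hi : i ∈ critClass A ℓ) :
    lastDiag A i = alpha A ℓ :=
  dDiag_eq (Nat.le_sub_one_of_lt hℓ) hi

theorem lastDiag_lt (hA : Irreducible A) {ℓ : ℕ} (hℓ : ℓ < numCrit A) {i : Fin n}
    (hi : i ∈ nodesBefore A ℓ) : lastDiag A i < alpha A ℓ := by
  obtain ⟨m, hm, him⟩ := Finset.mem_biUnion.1 hi
  rw [Finset.mem_range] at hm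
  rw [lastDiag_eq (hm.trans hℓ) him]
  exact alpha_lt_alpha hA hm hℓ

theorem lt_lastDiag (hA : Irreducible A) {ℓ : ℕ} {i : Fin n} (hi : i ∈ nodesFrom A (ℓ + 1)) :
    alpha A ℓ < lastDiag A i := by
  obtain ⟨m, hm, hmk, him⟩ := exists_mem_critClass hA hi
  rw [lastDiag_eq hmk him]
  exact alpha_lt_alpha hA hm hmk

/-! ### Potentials and eigenvectors of the matrix `Â` -/

theorem hat_apply (i j : Fin n) : hat A i j = ((-lastDiag A i : ℝ) : WithTop ℝ) + A i j := rfl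

/-- Backward induction, with `t` stages after `ℓ`. At the last stage all nodes are critical, so the
diagonal is constant there and a potential of that stage serves. -/
theorem exists_isSubeigenvector_stage (hA : Irreducible A) (t ℓ : ℕ) (h : ℓ + t + 1 = numCrit A) :
    ∃ V, IsSubeigenvector (nodesFrom A ℓ) (stage A ℓ).2 (lastDiag A) V ∧
      ∃ i ∈ nodesFrom A ℓ, V i ≠ ⊤ := by
  induction t generalizing ℓ with
  | zero =>
    have hne := nodesFrom_nonempty (A := A) (ℓ := ℓ) (by omega)
    obtain ⟨U, hU⟩ := exists_isPotential (rhoMin_stage hA hne)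
    have hall : nodesFrom A ℓ ⊆ critClass A ℓ := by
      rw [← Finset.sdiff_eq_empty_iff_subset, ← nodesFrom_succ, show ℓ + 1 = numCrit A by omega,
        nodesFrom_numCrit hA]
    obtain ⟨i, hi⟩ := hne
    exact ⟨_, hU.isSubeigenvector fun i hi => lastDiag_eq (by omega) (hall hi), i, hi,
      WithTop.coe_ne_top⟩
  | succ t ih =>
    obtain ⟨V, hV, i, hi, hVi⟩ := ih (ℓ + 1) (by omega)
    obtain ⟨U, hU⟩ := exists_isPotential (rhoMin_stage hA (nodesFrom_nonempty (A := A) (ℓ := ℓ)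
      (by omega)))
    obtain ⟨V', h1, h2⟩ := IsSubeigenvector.extend hU (critClass_subset A ℓ)
      (fun i hi => lastDiag_eq (by omega) hi) hV
    exact ⟨V', h1, i, (Finset.mem_sdiff.1 hi).1, by rwa [h2 i hi]⟩

theorem ne_top_of_propagates (hA : Irreducible A) {V : Fin n → WithTop ℝ}
    (hV : ∀ i j, V i = ⊤ → A i j ≠ ⊤ → V j = ⊤) {i₀ : Fin n} (h0 : V i₀ ≠ ⊤) (i : Fin n) :
    V i ≠ ⊤ := by
  intro hi
  refine h0 ?_
  have h := hA i i₀
  generalize i₀ = j at h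
  induction h with
  | single h => exact hV _ _ hi h
  | tail _ h ih => exact hV _ _ ih h

theorem exists_isPotential_hat (hA : Irreducible A) (hk : 0 < numCrit A) :
    ∃ U, IsPotential Finset.univ (hat A) 0 U := by
  obtain ⟨V, hV, i₀, -, h0⟩ := exists_isSubeigenvector_stage hA (numCrit A - 1) 0 (by omega)
  have hV : ∀ i j, V i ≤ hat A i j + V j := fun i j => hV i (Finset.mem_univ _) j (Finset.mem_univ _)
  have hfin := ne_top_of_propagates hA (fun i j hi hij => by
    have := hV i j
    rw [hi, top_le_iff, WithTop.add_eq_top, hat_apply, WithTop.add_eq_top] at this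
    exact this.resolve_left fun h => h.elim WithTop.coe_ne_top hij) h0
  refine ⟨fun i => (V i).untop (hfin i), fun i _ j _ w hw => ?_⟩
  have := hV i j
  rw [← WithTop.coe_le_coe, WithTop.coe_add, WithTop.coe_add]
  simpa [hw] using this

theorem rhoMin_eq_of_isPotential {L : Finset (Fin n)} {B : Matrix (Fin n) (Fin n) (WithTop ℝ)}
    {ρ : ℝ} {U : Fin n → ℝ} (hU : IsPotential L B ρ U) {k : ℕ} (hk : 0 < k) (hkL : k ≤ L.card)
    {c : Fin k → Fin n} (hc : ∀ m, c m ∈ L) {w : Fin k → ℝ}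
    (hw : ∀ m, B (c m) (c (finRotate k m)) = w m) (hs : ∑ m, w m = k * ρ) : rhoMin L B = ρ := by
  refine le_antisymm ((rhoMin_le hk hkL hc).trans_eq ?_) ?_
  · rw [circuitMean_eq_coe hk, circuitWeight_eq_coe hw, hs]
  · refine Finset.le_inf fun k hk => Finset.le_inf fun c hc => ?_
    have hk := (Finset.mem_Icc.1 hk).1
    cases hx : circuitMean B c using WithTop.recTopCoe with
    | top => exact le_top
    | coe x =>
      obtain ⟨w, hw, hs⟩ := exists_arc_weights ((circuitMean_eq_coe hk).1 hx)
      have h1 := (sum_le_circuit hU (Fintype.mem_piFinset.1 hc) hw).1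
      rw [hs] at h1
      exact WithTop.coe_le_coe.2 (le_of_mul_le_mul_left h1 (by exact_mod_cast hk))

/-- A critical circuit of `A` stays in the first class, where the diagonal equals its mean, so its
mean in `Â` is `0`. The potential of `Â` forbids smaller means. -/
theorem rhoMin_hat (hA : Irreducible A) (hk : 0 < numCrit A) :
    rhoMin Finset.univ (hat A) = (0 : ℝ) := by
  classical
  obtain ⟨U, hU⟩ := exists_isPotential_hat hA hk
  have hρ := rhoMin_stage hA (nodesFrom_nonempty hk)
  obtain ⟨k, hk0, hkL, c, hc, w, hw, hs⟩ := exists_circuit_eq_rhoMin hρ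
  have hcrit : IsCriticalCircuit (nodesFrom A 0) (stage A 0).2 c :=
    ⟨hk0, hc, fun m => (hw m).trans_ne WithTop.coe_ne_top, by
      rw [hρ, circuitMean_eq_coe hk0, circuitWeight_eq_coe hw, hs]⟩
  have hd : ∀ m, lastDiag A (c m) = alpha A 0 := fun m =>
    lastDiag_eq hk (Finset.mem_filter.2 ⟨hc m, k, c, hcrit, m, rfl⟩)
  refine rhoMin_eq_of_isPotential hU hk0 hkL (c := c) (fun m => Finset.mem_univ _)
    (w := fun m => -alpha A 0 + w m) (fun m => ?_) ?_
  · rw [hat_apply, hd, WithTop.coe_add]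
    exact congrArg _ (hw m)
  · rw [Finset.sum_add_distrib, hs]
    simp

/-- Irreducibility makes the eigenvector and its eigenvalue finite. The eigenvalue is then `0`, so
the eigenvector is itself a potential and saturation means tightness. -/
theorem IsEigenvector.exists_potential (hA : Irreducible A) (hk : 0 < numCrit A)
    {V : Fin n → WithTop ℝ} (hV : IsEigenvector (hat A) V) :
    ∃ U, IsPotential Finset.univ (hat A) 0 U ∧
      satGraph (hat A) V = Tight Finset.univ (hat A) 0 U := by
  obtain ⟨hne, lam, hlam⟩ := hV
  obtain ⟨i₀, h0⟩ := Function.ne_iff.1 hne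
  have hfin := ne_top_of_propagates hA (fun i j hi hij => by
    have h1 := hlam i
    rw [hi, WithTop.add_top] at h1
    have h2 : hat A i j + V j = ⊤ := (Finset.inf_eq_top_iff _ _).1 h1 j (Finset.mem_univ _)
    rw [WithTop.add_eq_top, hat_apply, WithTop.add_eq_top] at h2
    exact h2.resolve_left fun h => h.elim WithTop.coe_ne_top hij) h0
  choose u hu using fun i => WithTop.ne_top_iff_exists.1 (hfin i)
  have hle : ∀ i j, lam + V i ≤ hat A i j + V j := fun i j => by
    rw [← hlam]; exact Finset.inf_le (Finset.mem_univ j)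
  have hl : lam ≠ ⊤ := by
    rintro rfl
    obtain ⟨j, hj, -⟩ := TransGen.head'_iff.1 (hA i₀ i₀)
    have := hle i₀ j
    rw [WithTop.top_add, top_le_iff, WithTop.add_eq_top, hat_apply, WithTop.add_eq_top] at this
    exact this.elim (fun h => h.elim WithTop.coe_ne_top hj) (hfin j)
  obtain ⟨l, rfl⟩ := WithTop.ne_top_iff_exists.1 hl
  have hpot : IsPotential Finset.univ (hat A) l u := by
    intro i _ j _ w hw
    have := hle i j
    rw [hw, ← hu, ← hu, ← WithTop.coe_add, ← WithTop.coe_add, WithTop.coe_le_coe] at this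
    linarith
  have hl0 : l = 0 := by
    apply le_antisymm
    · obtain ⟨k, hk0, -, c, hc, w, hw, hs⟩ := exists_circuit_eq_rhoMin (rhoMin_hat hA hk)
      have h1 := (sum_le_circuit hpot hc hw).1
      rw [hs] at h1
      exact le_of_mul_le_mul_left h1 (by exact_mod_cast hk0)
    · obtain ⟨U, hU⟩ := exists_isPotential_hat hA hk
      have : Nonempty (Fin n) := ⟨i₀⟩
      -- At a minimum of `u - U`, a saturated arc from `i` has slack at least `0` for `U`, which
      -- forces `l ≥ 0`. The circuit of mean `0` gave `l ≤ 0`.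
      obtain ⟨i, hi⟩ := Finite.exists_min fun i => u i - U i
      have h1 := hlam i
      rw [← hu, ← WithTop.coe_add] at h1
      obtain ⟨j, -, h2⟩ := exists_eq_of_inf_eq_coe h1
      obtain ⟨w, v, h3, h4, h5⟩ := WithTop.add_eq_coe.1 h2
      rw [← hu, WithTop.coe_inj] at h4
      have h6 := hU i (Finset.mem_univ _) j (Finset.mem_univ _) w h3.symm
      have h7 := hi j
      linarith
  subst hl0
  refine ⟨u, hpot, ?_⟩
  funext i j
  apply propext
  rw [satGraph, hlam, ← hu, ← hu, ← WithTop.coe_add]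
  constructor
  · intro h
    obtain ⟨w, v, h3, h4, h5⟩ := WithTop.add_eq_coe.1 h.symm
    rw [WithTop.coe_inj] at h4
    exact ⟨Finset.mem_univ _, Finset.mem_univ _, w, h3.symm, by linarith⟩
  · rintro ⟨-, -, w, hw, h⟩
    rw [hw, ← WithTop.coe_add, WithTop.coe_inj]
    linarith

end Stages

/-! ### Determinants of blocks -/

/-- The determinant of the `C × C` block of `diag D - b`. -/
noncomputable def blockDet (b : Matrix (Fin n) (Fin n) ℂ) (C : Finset (Fin n)) (D : Fin n → ℂ) :
    ℂ :=
  (Matrix.diagonal (fun i : C => D i) - block C C b).det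

/-- Arcs that do not lie on circuits do not contribute to determinants. -/
theorem blockDet_restrictGraph_eq (a : Matrix (Fin n) (Fin n) ℂ) {G H : Fin n → Fin n → Prop}
    (hGH : ∀ i j, H i j ↔ G i j ∧ ReflTransGen G j i) (C : Finset (Fin n)) (D : Fin n → ℂ) :
    blockDet (restrictGraph a H) C D = blockDet (restrictGraph a G) C D := by
  classical
  rw [blockDet, blockDet, Matrix.det_apply', Matrix.det_apply']
  refine Finset.sum_congr rfl fun σ _ => congrArg _ ?_
  simp only [Matrix.sub_apply, Matrix.diagonal_apply, block, Matrix.submatrix_apply, restrictGraph]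
  -- If all moved points of `σ` give arcs of `G`, these arcs lie on cycles of `σ`, so `H` and `G`
  -- agree on them. Otherwise both products contain a zero factor.
  by_cases hall : ∀ i : C, σ i ≠ i → G (σ i) i
  · refine Finset.prod_congr rfl fun i _ => ?_
    have hback : ReflTransGen G i (σ i) := by
      have h := reflTransGen_of_perm (R := fun x y : C => G x y) σ⁻¹ (fun x => by
        by_cases hx : σ (σ⁻¹ x) = σ⁻¹ x
        · rw [Equiv.Perm.inv_def, Equiv.apply_symm_apply] at hx
          rw [Equiv.Perm.inv_def, ← hx]
        · have := hall _ hx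
          rw [Equiv.Perm.inv_def, Equiv.apply_symm_apply] at this
          exact .single this) (σ i)
      rw [Equiv.Perm.inv_def, Equiv.symm_apply_apply] at h
      exact ReflTransGen.lift (fun x : C => (x : Fin n)) (fun _ _ h => h) _ _ h
    have hiff : H (σ i) i ↔ G (σ i) i := by
      rw [hGH]; exact and_iff_left hback
    simp only [hiff]
  · push Not at hall
    obtain ⟨i, hi, hG⟩ := hall
    have hH : ¬ H (σ i) i := fun h => hG ((hGH _ _).1 h).1
    rw [Finset.prod_eq_zero (Finset.mem_univ i) (by simp [hi, hH]),
      Finset.prod_eq_zero (Finset.mem_univ i) (by simp [hi, hG])]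

theorem det_neg_block (b : Matrix (Fin n) (Fin n) ℂ) (C : Finset (Fin n)) :
    (-block C C b).det = blockDet b C 0 := by
  rw [blockDet]
  congr 1
  ext i j
  simp

theorem isUnit_block_iff (b : Matrix (Fin n) (Fin n) ℂ) (C : Finset (Fin n)) :
    IsUnit (block C C b) ↔ blockDet b C 0 ≠ 0 := by
  rw [← det_neg_block, ← isUnit_iff_ne_zero, ← Matrix.isUnit_iff_isUnit_det, IsUnit.neg_iff]

/-- The determinant formula for a block matrix with invertible leading block `-b_CC`; the two minus
signs cancel in the Schur complement. -/
theorem blockDet_union (b : Matrix (Fin n) (Fin n) ℂ) {C K : Finset (Fin n)} (h : Disjoint C K)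
    (hr : IsUnit (block C C b)) (x : ℂ) {D : Fin n → ℂ} (hC : ∀ i ∈ C, D i = 0)
    (hK : ∀ i ∈ K, D i = x) :
    blockDet b (C ∪ K) D = blockDet b C 0 * (Matrix.scalar K x -
      (block K K b - block K C b * (block C C b)⁻¹ * block C K b)).det := by
  classical
  have hr' : IsUnit (-block C C b) := hr.neg
  have := hr'.invertible
  have hinv : ⅟(-block C C b) = -(block C C b)⁻¹ := by
    apply invOf_eq_right_inv
    rw [neg_mul_neg, Matrix.mul_nonsing_inv _ ((Matrix.isUnit_iff_isUnit_det _).1 hr)]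
  have hblocks : (Matrix.diagonal (fun i : (C ∪ K : Finset (Fin n)) => D i) -
      block (C ∪ K) (C ∪ K) b).submatrix (Equiv.Finset.union C K h) (Equiv.Finset.union C K h) =
      Matrix.fromBlocks (-block C C b) (-block C K b) (-block K C b)
        (Matrix.scalar K x - block K K b) := by
    have hne : ∀ (i : C) (j : K), (i : Fin n) ≠ j := fun i j hij =>
      Finset.disjoint_left.1 h i.2 (hij ▸ j.2)
    ext (i | i) (j | j)
    · simp [Matrix.diagonal_apply, block, hC]
    · simp [block, Subtype.ext_iff, hne]
    · simp [block, Subtype.ext_iff, (hne _ _).symm]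
    · simp [Matrix.diagonal_apply, block, hK]
  rw [blockDet, ← Matrix.det_submatrix_equiv_self (Equiv.Finset.union C K h), hblocks,
    Matrix.det_fromBlocks₁₁, hinv, det_neg_block]
  congr 2
  simp only [Matrix.mul_neg, Matrix.neg_mul, neg_neg]
  abel

section Schur

variable {A : Matrix (Fin n) (Fin n) (WithTop ℝ)} {a : Matrix (Fin n) (Fin n) ℂ}
  {G : Fin n → Fin n → Prop} {ℓ : ℕ}

theorem blockDet_nodesBefore_succ (hr : IsUnit (rMat A a G ℓ)) (x : ℂ) {D : Fin n → ℂ}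
    (hC : ∀ i ∈ nodesBefore A ℓ, D i = 0) (hK : ∀ i ∈ critClass A ℓ, D i = x) :
    blockDet (restrictGraph a G) (nodesBefore A (ℓ + 1)) D =
      blockDet (restrictGraph a G) (nodesBefore A ℓ) 0 * (tMat A a G ℓ).charpoly.eval x := by
  rw [nodesBefore_succ, blockDet_union _ (disjoint_nodesBefore_critClass ℓ) hr x hC hK,
    Matrix.eval_charpoly]
  rfl

theorem isUnit_rMat_iff :
    IsUnit (rMat A a G ℓ) ↔ blockDet (restrictGraph a G) (nodesBefore A ℓ) 0 ≠ 0 :=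
  isUnit_block_iff _ _

/-- The characteristic polynomial of `t` is a quotient of two block determinants, so it depends on
the graph only through these. -/
theorem charpoly_tMat_eq {G' : Fin n → Fin n → Prop}
    (h : ∀ C D, blockDet (restrictGraph a G) C D = blockDet (restrictGraph a G') C D)
    (hr : IsUnit (rMat A a G ℓ)) : (tMat A a G ℓ).charpoly = (tMat A a G' ℓ).charpoly := by
  classical
  have hr' : IsUnit (rMat A a G' ℓ) := by
    rwa [isUnit_rMat_iff, ← h, ← isUnit_rMat_iff]
  apply Polynomial.funext
  intro x
  set D : Fin n → ℂ := fun i => if i ∈ critClass A ℓ then x else 0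
  have hC : ∀ i ∈ nodesBefore A ℓ, D i = 0 := fun i hi =>
    if_neg (Finset.disjoint_left.1 (disjoint_nodesBefore_critClass ℓ) hi)
  have hK : ∀ i ∈ critClass A ℓ, D i = x := fun i hi => if_pos hi
  have h1 := h (nodesBefore A (ℓ + 1)) D
  rw [blockDet_nodesBefore_succ hr x hC hK, blockDet_nodesBefore_succ hr' x hC hK, ← h] at h1
  exact mul_left_cancel₀ (isUnit_rMat_iff.1 hr) h1

/-- At `x = 0` the Schur formula gives `det (-r)` at stage `ℓ + 1` as the product of `det (-r)` and
`det (-t)` at stage `ℓ`. -/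
theorem isUnit_rMat_of_isUnit_tMat {K : ℕ} (h : ∀ ℓ < K, IsUnit (tMat A a G ℓ)) :
    ∀ ℓ < K, IsUnit (rMat A a G ℓ) := by
  intro ℓ
  induction ℓ with
  | zero =>
    intro _
    rw [isUnit_rMat_iff, blockDet]
    have : IsEmpty (nodesBefore A 0) := Finset.isEmpty_coe_sort.2 rfl
    simp
  | succ ℓ ih =>
    intro hℓ
    have hr := ih (by omega)
    rw [isUnit_rMat_iff, blockDet_nodesBefore_succ hr 0 (D := 0) (fun _ _ => rfl) fun _ _ => rfl]
    refine mul_ne_zero (isUnit_rMat_iff.1 hr) ?_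
    rw [Matrix.eval_charpoly, map_zero, zero_sub, ← isUnit_iff_ne_zero,
      ← Matrix.isUnit_iff_isUnit_det, IsUnit.neg_iff]
    exact h ℓ (by omega)

theorem zero_notMem_roots_charpoly {ι : Type} [Fintype ι] [DecidableEq ι] {t : Matrix ι ι ℂ}
    (ht : IsUnit t) : (0 : ℂ) ∉ t.charpoly.roots := by
  intro h
  have h1 := (Polynomial.mem_roots'.1 h).2
  rw [Polynomial.IsRoot, Matrix.eval_charpoly, map_zero, zero_sub] at h1
  have h2 := (Matrix.isUnit_iff_isUnit_det _).1 ht.neg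
  rw [h1] at h2
  simp at h2

/-! ### The rescaled characteristic polynomial -/

/-- The rows in `N` are `x` times rows of the identity, so the matrix is block triangular. -/
theorem det_eq_blockDet_mul (b : Matrix (Fin n) (Fin n) ℂ) {C N : Finset (Fin n)}
    (hCN : ∀ i, i ∉ C ↔ i ∈ N) {D : Fin n → ℂ} {x : ℂ} (hN : ∀ i ∈ N, D i = x)
    {M : Matrix (Fin n) (Fin n) ℂ}
    (hM : ∀ i j, M i j = (if i = j then D i else 0) - if i ∈ N then 0 else b i j) :
    M.det = blockDet b C D * x ^ N.card := by
  classical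
  rw [Matrix.twoBlockTriangular_det M (fun i => i ∈ C)]
  · have h1 : (M.toSquareBlockProp fun i => i ∈ C).det = blockDet b C D := by
      rw [blockDet]
      congr 1
      ext i j
      have hi : (i : Fin n) ∉ N := fun h => (hCN i).2 h i.2
      rw [Matrix.toSquareBlockProp_def, Matrix.of_apply, hM, if_neg hi, Matrix.sub_apply,
        Matrix.diagonal_apply]
      simp only [Subtype.coe_inj]
      rfl
    have h2 : (M.toSquareBlockProp fun i => ¬ i ∈ C) = Matrix.diagonal fun _ => x := by
      ext i j
      have hi := (hCN i).1 i.2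
      rw [Matrix.toSquareBlockProp_def, Matrix.of_apply, hM, if_pos hi, Matrix.diagonal_apply,
        hN _ hi, sub_zero]
      simp only [Subtype.coe_inj]
    have h3 : Fintype.card {i // ¬ i ∈ C} = N.card := by
      rw [Fintype.card_subtype]
      congr 1
      ext i
      simp [hCN]
    refine congrArg₂ (· * ·) ?_ ?_
    · convert h1
    · rw [h2, Matrix.det_diagonal, Finset.prod_const, Finset.card_univ]
      convert rfl
      exact h3.symm
  · intro i hi j hj
    rw [hM, if_pos ((hCN i).1 hi), if_neg (by rintro rfl; exact hi hj), sub_zero]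

/-- The limit of the characteristic polynomial rescaled at stage `ℓ`. -/
noncomputable def limitPoly (A : Matrix (Fin n) (Fin n) (WithTop ℝ)) (a : Matrix (Fin n) (Fin n) ℂ)
    (G : Fin n → Fin n → Prop) (ℓ : ℕ) : Polynomial ℂ :=
  Polynomial.C (blockDet (restrictGraph a G) (nodesBefore A ℓ) 0) *
    (Polynomial.X ^ (nodesFrom A (ℓ + 1)).card * (tMat A a G ℓ).charpoly)

theorem det_eq_eval_limitPoly {D : Fin n → ℂ} {x : ℂ} (hr : IsUnit (rMat A a G ℓ))
    (hC : ∀ i ∈ nodesBefore A ℓ, D i = 0) (hK : ∀ i ∈ nodesFrom A ℓ, D i = x)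
    {G' : Fin n → Fin n → Prop}
    (h : ∀ C D, blockDet (restrictGraph a G') C D = blockDet (restrictGraph a G) C D)
    {M : Matrix (Fin n) (Fin n) ℂ}
    (hM : ∀ i j, M i j = (if i = j then D i else 0) -
      if i ∈ nodesFrom A (ℓ + 1) then 0 else restrictGraph a G' i j) :
    M.det = (limitPoly A a G ℓ).eval x := by
  rw [det_eq_blockDet_mul _ (C := nodesBefore A (ℓ + 1))
    (fun i => by rw [mem_nodesBefore_iff, not_not])
    (fun i hi => hK i (nodesFrom_anti ℓ.le_succ hi)) hM, h,
    blockDet_nodesBefore_succ hr x hC fun i hi => hK i (critClass_subset A ℓ hi), limitPoly]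
  simp only [Polynomial.eval_mul, Polynomial.eval_C, Polynomial.eval_pow, Polynomial.eval_X]
  ring

theorem limitPoly_ne_zero (hr : IsUnit (rMat A a G ℓ)) : limitPoly A a G ℓ ≠ 0 :=
  mul_ne_zero (Polynomial.C_ne_zero.2 (isUnit_rMat_iff.1 hr))
    (mul_ne_zero (pow_ne_zero _ Polynomial.X_ne_zero) (Matrix.charpoly_monic _).ne_zero)

theorem roots_limitPoly (hr : IsUnit (rMat A a G ℓ)) : (limitPoly A a G ℓ).roots =
    (nodesFrom A (ℓ + 1)).card • {0} + (tMat A a G ℓ).charpoly.roots := by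
  rw [limitPoly, Polynomial.roots_C_mul _ (isUnit_rMat_iff.1 hr), Polynomial.roots_mul
    (mul_ne_zero (pow_ne_zero _ Polynomial.X_ne_zero) (Matrix.charpoly_monic _).ne_zero),
    Polynomial.roots_X_pow]

theorem filter_roots_limitPoly (hr : IsUnit (rMat A a G ℓ)) :
    (limitPoly A a G ℓ).roots.filter (· ≠ 0) = nonzeroEigenvalues (tMat A a G ℓ) := by
  rw [roots_limitPoly hr, Multiset.filter_add, Multiset.nsmul_singleton,
    Multiset.filter_eq_nil.2 fun z hz => not_not.2 (Multiset.eq_of_mem_replicate hz), zero_add]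
  rfl

theorem card_roots_charpoly {ι : Type} [Fintype ι] [DecidableEq ι] (t : Matrix ι ι ℂ) :
    t.charpoly.roots.card = Fintype.card ι := by
  rw [← (IsAlgClosed.splits t.charpoly).natDegree_eq_card_roots, Matrix.charpoly_natDegree_eq_dim]

theorem card_roots_limitPoly (hr : IsUnit (rMat A a G ℓ)) :
    (limitPoly A a G ℓ).roots.card = (nodesFrom A ℓ).card := by
  have h := Finset.card_sdiff_of_subset (critClass_subset A ℓ)
  have h' := Finset.card_le_card (critClass_subset A ℓ)
  rw [roots_limitPoly hr, Multiset.card_add, Multiset.card_nsmul, Multiset.card_singleton,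
    card_roots_charpoly, Fintype.card_coe, nodesFrom_succ, h]
  simp only [mul_one]
  omega

end Schur

/-! ### Leading terms multiplied by powers of `ε` -/

theorem tendsto_rpow_nhdsGT_zero {t : ℝ} (ht : 0 ≤ t) :
    Tendsto (fun ε : ℝ => ε ^ t) (𝓝[>] 0) (𝓝 (if t = 0 then 1 else 0)) := by
  have h := ((Real.continuous_rpow_const ht).tendsto 0).mono_left
    (nhdsWithin_le_nhds (s := Set.Ioi 0))
  have h0 : (0 : ℝ) ^ t = if t = 0 then 1 else 0 := by
    split_ifs with h0
    · rw [h0, Real.rpow_zero]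
    · exact Real.zero_rpow h0
  rwa [h0] at h

theorem HasLeading.tendsto_rpow_mul {f : ℝ → ℂ} {c : ℂ} {e s : ℝ}
    (h : HasLeading f c (e : WithTop ℝ)) (hs : 0 ≤ s + e) :
    Tendsto (fun ε : ℝ => ((ε ^ s : ℝ) : ℂ) * f ε) (𝓝[>] 0) (𝓝 (if s + e = 0 then c else 0)) := by
  have h' : (fun ε => f ε - c * ((ε ^ e : ℝ) : ℂ)) =o[𝓝[>] (0 : ℝ)] fun ε => ε ^ e := h
  have hp := tendsto_rpow_nhdsGT_zero hs
  have hmul : (fun ε : ℝ => ε ^ s * ε ^ e) =ᶠ[𝓝[>] 0] fun ε : ℝ => ε ^ (s + e) := by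
    filter_upwards [self_mem_nhdsWithin] with ε hε using (Real.rpow_add hε _ _).symm
  have h1 : (fun ε : ℝ => ((ε ^ s : ℝ) : ℂ)) =O[𝓝[>] (0 : ℝ)] fun ε => ε ^ s :=
    IsBigO.of_bound 1 (Eventually.of_forall fun ε => by simp)
  have h2 := ((h1.mul_isLittleO h').trans_eventuallyEq hmul).tendsto_zero_of_tendsto hp
  have h3 := (((Complex.continuous_ofReal.tendsto _).comp hp).const_mul c)
  have h4 := h2.add h3
  have hlim : (0 : ℂ) + c * ((if s + e = 0 then (1 : ℝ) else 0 : ℝ) : ℂ) =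
      if s + e = 0 then c else 0 := by split_ifs <;> simp
  rw [hlim] at h4
  refine h4.congr' ?_
  filter_upwards [hmul] with ε hε
  simp only [Function.comp_apply, ← hε]
  push_cast
  ring

/-! ### Limits of the rescaled eigenvalues -/

section Main

variable {𝒜 : ℝ → Matrix (Fin n) (Fin n) ℂ} {a : Matrix (Fin n) (Fin n) ℂ}
  {A : Matrix (Fin n) (Fin n) (WithTop ℝ)} {G : Fin n → Fin n → Prop} {ℓ : ℕ} {U : Fin n → ℝ}
  {ev : Fin n → ℝ → ℂ}

/-- The total exponent is the slack of the arc for `U` plus `lastDiag A i - min (lastDiag A i)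
(alpha A ℓ)`. The second term is positive exactly on the later classes; where it vanishes, only
tight arcs have exponent `0`. -/
theorem tendsto_scaled_entry {f : ℝ → ℂ} {i j : Fin n} {s : ℝ} (hA : Irreducible A)
    (hℓ : ℓ < numCrit A) (hU : IsPotential Finset.univ (hat A) 0 U)
    (hs : s = -U i - min (lastDiag A i) (alpha A ℓ) + U j) (hf : HasLeading f (a i j) (A i j)) :
    Tendsto (fun ε : ℝ => ((ε ^ s : ℝ) : ℂ) * f ε) (𝓝[>] 0) (𝓝 (if i ∈ nodesFrom A (ℓ + 1) then 0
      else restrictGraph a (Tight Finset.univ (hat A) 0 U) i j)) := by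
  cases hw : A i j using WithTop.recTopCoe with
  | top =>
    have h0 : ¬ Tight Finset.univ (hat A) 0 U i j := by
      rintro ⟨-, -, w, h, -⟩
      rw [hat_apply, hw, WithTop.add_top] at h
      exact WithTop.top_ne_coe h
    rw [restrictGraph, if_neg h0, ite_self]
    rw [hw] at hf
    have hf' : ∀ᶠ ε in 𝓝[>] (0 : ℝ), f ε = 0 := hf
    refine tendsto_const_nhds.congr' ?_
    filter_upwards [hf'] with ε hε
    rw [hε, mul_zero]
  | coe w =>
    have hhat : hat A i j = ((-lastDiag A i + w : ℝ) : WithTop ℝ) := by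
      rw [hat_apply, hw, WithTop.coe_add]
    have h1 := hU i (Finset.mem_univ _) j (Finset.mem_univ _) _ hhat
    have h2 := min_le_left (lastDiag A i) (alpha A ℓ)
    rw [hw] at hf
    convert hf.tendsto_rpow_mul (s := s) (by linarith) using 2
    have hT : Tight Finset.univ (hat A) 0 U i j ↔ U i + 0 = -lastDiag A i + w + U j := by
      constructor
      · rintro ⟨-, -, w', h, h'⟩
        rw [hhat, WithTop.coe_inj] at h
        rw [h, h']
      · exact fun h => ⟨Finset.mem_univ _, Finset.mem_univ _, _, hhat, h⟩
    by_cases hi : i ∈ nodesFrom A (ℓ + 1)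
    · have h3 := lt_lastDiag hA hi
      rw [min_eq_right h3.le] at hs
      rw [if_pos hi, if_neg (by linarith)]
    · have h3 : lastDiag A i ≤ alpha A ℓ := by
        rw [← mem_nodesBefore_iff, nodesBefore_succ, Finset.mem_union] at hi
        exact hi.elim (fun h => (lastDiag_lt hA hℓ h).le) fun h => (lastDiag_eq hℓ h).le
      rw [min_eq_left h3] at hs
      rw [if_neg hi, restrictGraph]
      by_cases hTi : Tight Finset.univ (hat A) 0 U i j
      · rw [if_pos hTi, if_pos (by linarith [hT.1 hTi])]
      · rw [if_neg hTi, if_neg fun h => hTi (hT.2 (by linarith))]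

open Classical in
theorem tendsto_scaled_diag {i : Fin n} {s : ℝ} (x : ℂ) (hA : Irreducible A) (hℓ : ℓ < numCrit A)
    (hs : s = alpha A ℓ - min (lastDiag A i) (alpha A ℓ)) :
    Tendsto (fun ε : ℝ => ((ε ^ s : ℝ) : ℂ) * x) (𝓝[>] 0)
      (𝓝 (if i ∈ nodesBefore A ℓ then 0 else x)) := by
  have h0 : 0 ≤ s := by linarith [min_le_right (lastDiag A i) (alpha A ℓ)]
  have h : Tendsto (fun ε : ℝ => ((ε ^ s : ℝ) : ℂ) * x) _ _ :=
    ((Complex.continuous_ofReal.tendsto _).comp (tendsto_rpow_nhdsGT_zero h0)).mul_const x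
  convert h using 2
  by_cases hi : i ∈ nodesBefore A ℓ
  · have h3 := lastDiag_lt hA hℓ hi
    rw [min_eq_left h3.le] at hs
    rw [if_pos hi, if_neg (by linarith)]
    simp
  · have h3 : alpha A ℓ ≤ lastDiag A i := by
      by_cases hi' : i ∈ critClass A ℓ
      · exact (lastDiag_eq hℓ hi').ge
      · rw [mem_nodesBefore_iff, not_not] at hi
        exact (lt_lastDiag hA (Finset.mem_sdiff.2 ⟨hi, hi'⟩)).le
    rw [min_eq_right h3, sub_self] at hs
    rw [if_neg hi, if_pos hs]
    simp

theorem exists_tendsto_rescaled_charpoly (hA : Irreducible A)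
    (hlead : ∀ i j, HasLeading (fun ε => 𝒜 ε i j) (a i j) (A i j)) (hℓ : ℓ < numCrit A)
    (hU : IsPotential Finset.univ (hat A) 0 U)
    (hG : ∀ C D, blockDet (restrictGraph a (Tight Finset.univ (hat A) 0 U)) C D =
      blockDet (restrictGraph a G) C D)
    (hr : IsUnit (rMat A a G ℓ)) (hev : IsEigenvalueFamily 𝒜 ev) :
    ∃ g : ℝ → ℂ, ∀ x, Tendsto (fun ε => g ε * ∏ i, (x - ev i ε * ((ε ^ (-alpha A ℓ) : ℝ) : ℂ)))
      (𝓝[>] 0) (𝓝 ((limitPoly A a G ℓ).eval x)) := by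
  classical
  set α := alpha A ℓ with hα
  set e : Fin n → ℝ := fun i => -U i - min (lastDiag A i) α with he
  refine ⟨fun ε => (∏ i, ((ε ^ e i : ℝ) : ℂ)) * ((∏ j, ((ε ^ U j : ℝ) : ℂ)) *
    ∏ _i : Fin n, ((ε ^ α : ℝ) : ℂ)), fun x => ?_⟩
  set M : ℝ → Matrix (Fin n) (Fin n) ℂ := fun ε => Matrix.of fun i j =>
    ((ε ^ e i : ℝ) : ℂ) * (((ε ^ U j : ℝ) : ℂ) *
      (Matrix.scalar (Fin n) (((ε ^ α : ℝ) : ℂ) * x) - 𝒜 ε) i j) with hM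
  have hdet : ∀ᶠ ε in 𝓝[>] (0 : ℝ), (M ε).det = (∏ i, ((ε ^ e i : ℝ) : ℂ)) *
      ((∏ j, ((ε ^ U j : ℝ) : ℂ)) * ∏ _i : Fin n, ((ε ^ α : ℝ) : ℂ)) *
      ∏ i, (x - ev i ε * ((ε ^ (-α) : ℝ) : ℂ)) := by
    filter_upwards [hev.2, self_mem_nhdsWithin] with ε hε hpos
    have h1 := Matrix.det_mul_column (fun i => ((ε ^ e i : ℝ) : ℂ)) (Matrix.of fun i j =>
      ((ε ^ U j : ℝ) : ℂ) * (Matrix.scalar (Fin n) (((ε ^ α : ℝ) : ℂ) * x) - 𝒜 ε) i j)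
    have h2 := Matrix.det_mul_row (fun j => ((ε ^ U j : ℝ) : ℂ))
      (Matrix.scalar (Fin n) (((ε ^ α : ℝ) : ℂ) * x) - 𝒜 ε)
    rw [h2, eval_charpoly_eq_prod hε] at h1
    have h3 : ((ε ^ α : ℝ) : ℂ) * ((ε ^ (-α) : ℝ) : ℂ) = 1 := by
      rw [← Complex.ofReal_mul, ← Real.rpow_add hpos, add_neg_cancel, Real.rpow_zero,
        Complex.ofReal_one]
    have h4 : ∏ i, (((ε ^ α : ℝ) : ℂ) * x - ev i ε) =
        (∏ _i : Fin n, ((ε ^ α : ℝ) : ℂ)) * ∏ i, (x - ev i ε * ((ε ^ (-α) : ℝ) : ℂ)) := by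
      rw [← Finset.prod_mul_distrib]
      exact Finset.prod_congr rfl fun i _ => by linear_combination ev i ε * h3
    rw [h4] at h1
    refine h1.trans ?_
    ring
  set M₀ : Matrix (Fin n) (Fin n) ℂ := Matrix.of fun i j =>
    (if i = j then (if i ∈ nodesBefore A ℓ then 0 else x) else 0) -
      if i ∈ nodesFrom A (ℓ + 1) then 0 else
        restrictGraph a (Tight Finset.univ (hat A) 0 U) i j with hM₀
  have hlim : Tendsto M (𝓝[>] 0) (𝓝 M₀) := by
    refine tendsto_pi_nhds.2 fun i => tendsto_pi_nhds.2 fun j => ?_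
    have h1 := tendsto_scaled_entry hA hℓ hU (s := e i + U j) rfl (hlead i j)
    have h2 : Tendsto (fun ε : ℝ => ((ε ^ (e i + U j) : ℝ) : ℂ) *
        (if i = j then ((ε ^ α : ℝ) : ℂ) * x else 0)) (𝓝[>] 0)
        (𝓝 (if i = j then (if i ∈ nodesBefore A ℓ then 0 else x) else 0)) := by
      by_cases hij : i = j
      · subst hij
        simp only [if_true]
        refine (tendsto_scaled_diag x hA hℓ (s := e i + U i + α) ?_).congr' ?_
        · simp only [he]; ring
        · filter_upwards [self_mem_nhdsWithin] with ε hε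
          rw [Real.rpow_add hε (e i + U i), Complex.ofReal_mul, mul_assoc]
      · simp [hij]
    refine (h2.sub h1).congr' ?_
    filter_upwards [self_mem_nhdsWithin] with ε hε
    rw [Real.rpow_add hε, Complex.ofReal_mul]
    simp only [hM, Matrix.of_apply, Matrix.sub_apply, Matrix.scalar_apply, Matrix.diagonal_apply]
    ring
  rw [← det_eq_eval_limitPoly (D := fun i => if i ∈ nodesBefore A ℓ then 0 else x) hr
    (fun i hi => if_pos hi) (fun i hi => if_neg fun h => mem_nodesBefore_iff.1 h hi) hG
    (M := M₀) fun i j => rfl]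
  exact (((Continuous.matrix_det continuous_id).tendsto M₀).comp hlim).congr' hdet

theorem continuousOn_rescaled {f : ℝ → ℂ} (hf : ClassC f) (α : ℝ) : ∃ ε₁ > 0,
    ContinuousOn (fun ε : ℝ => f ε * ((ε ^ (-α) : ℝ) : ℂ)) (Set.Ioo 0 ε₁) := by
  obtain ⟨ε₁, h0, hc, -⟩ := hf
  refine ⟨ε₁, h0, hc.mul (Complex.continuous_ofReal.comp_continuousOn ?_)⟩
  exact continuousOn_id.rpow_const fun ε hε => Or.inl hε.1.ne'

theorem exists_rescaled_limits (hA : Irreducible A)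
    (hlead : ∀ i j, HasLeading (fun ε => 𝒜 ε i j) (a i j) (A i j)) (hℓ : ℓ < numCrit A)
    (hU : IsPotential Finset.univ (hat A) 0 U)
    (hG : ∀ C D, blockDet (restrictGraph a (Tight Finset.univ (hat A) 0 U)) C D =
      blockDet (restrictGraph a G) C D)
    (hr : IsUnit (rMat A a G ℓ)) (hev : IsEigenvalueFamily 𝒜 ev) :
    ∃ (S : Finset (Fin n)) (l : Fin n → ℂ),
      (∀ i ∈ S, Tendsto (fun ε => ev i ε * ((ε ^ (-alpha A ℓ) : ℝ) : ℂ)) (𝓝[>] 0) (𝓝 (l i))) ∧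
      (∀ i ∉ S, OrderOmega (ev i) (alpha A ℓ)) ∧ S.card = (nodesFrom A ℓ).card ∧
      (S.filter fun i => l i ≠ 0).val.map l = nonzeroEigenvalues (tMat A a G ℓ) := by
  obtain ⟨g, hg⟩ := exists_tendsto_rescaled_charpoly hA hlead hℓ hU hG hr hev
  choose ε hε hc using fun i => continuousOn_rescaled (hev.1 i) (alpha A ℓ)
  obtain ⟨ε₁, h1, h0⟩ : ∃ ε₁, (∀ i, ε₁ ≤ ε i) ∧ 0 < ε₁ := by
    have : ∀ᶠ ε₁ in 𝓝[>] (0 : ℝ), ∀ i, ε₁ ≤ ε i := eventually_all.2 fun i => by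
      filter_upwards [Ioo_mem_nhdsGT (hε i)] with x hx using hx.2.le
    exact (this.and self_mem_nhdsWithin).exists
  obtain ⟨S, l, h2, h3, h4⟩ := exists_limits_of_roots (limitPoly_ne_zero hr) h0
    (fun i => (hc i).mono (Set.Ioo_subset_Ioo_right (h1 i))) hg
  refine ⟨S, l, h2, h3, ?_, ?_⟩
  · rw [← card_roots_limitPoly hr, h4, Multiset.card_map]; rfl
  · rw [← filter_roots_limitPoly hr, h4, Multiset.filter_map]
    rfl

/-! ### From limits of rescaled germs to their orders -/

theorem rescaled_mul_rpow {f : ℝ → ℂ} (α : ℝ) :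
    (fun ε : ℝ => f ε * ((ε ^ (-α) : ℝ) : ℂ) * ((ε ^ α : ℝ) : ℂ)) =ᶠ[𝓝[>] 0] f := by
  filter_upwards [self_mem_nhdsWithin] with ε hε
  rw [mul_assoc, ← Complex.ofReal_mul, ← Real.rpow_add hε, neg_add_cancel, Real.rpow_zero,
    Complex.ofReal_one, mul_one]

theorem isTheta_ofReal_rpow (α : ℝ) :
    (fun ε : ℝ => ((ε ^ α : ℝ) : ℂ)) =Θ[𝓝[>] 0] fun ε : ℝ => ε ^ α :=
  IsTheta.of_norm_eventuallyEq_norm (Eventually.of_forall fun ε => by simp)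

theorem equiv0_of_tendsto {f : ℝ → ℂ} {α : ℝ} {l : ℂ} (hl : l ≠ 0)
    (h : Tendsto (fun ε => f ε * ((ε ^ (-α) : ℝ) : ℂ)) (𝓝[>] 0) (𝓝 l)) : Equiv0 f l α :=
  (((isEquivalent_const_iff_tendsto hl).2 h).mul IsEquivalent.refl).congr_left
    (rescaled_mul_rpow α)

theorem isLittleO_of_rescaled_tendsto {f : ℝ → ℂ} {α : ℝ}
    (h : Tendsto (fun ε => f ε * ((ε ^ (-α) : ℝ) : ℂ)) (𝓝[>] 0) (𝓝 0)) :
    f =o[𝓝[>] (0 : ℝ)] fun ε => ε ^ α := by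
  have h1 := ((isLittleO_one_iff ℝ).2 h).mul_isBigO (isTheta_ofReal_rpow α).isBigO
  refine IsLittleO.congr' h1 (rescaled_mul_rpow α) (Eventually.of_forall fun ε => ?_)
  exact one_mul _

theorem isTheta_of_equiv0 {f : ℝ → ℂ} {α : ℝ} {l : ℂ} (hl : l ≠ 0) (h : Equiv0 f l α) :
    f =Θ[𝓝[>] (0 : ℝ)] fun ε => ε ^ α :=
  h.isTheta.trans ((isTheta_const_mul_left hl).2 (isTheta_ofReal_rpow α))

theorem not_isTheta_of_isLittleO {f : ℝ → ℂ} {α : ℝ} (h : f =o[𝓝[>] (0 : ℝ)] fun ε => ε ^ α) :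
    ¬ f =Θ[𝓝[>] (0 : ℝ)] fun ε => ε ^ α := by
  intro hT
  have h1 := hT.isBigO_symm.trans_isLittleO h
  refine isLittleO_irrefl ?_ h1
  refine Eventually.frequently ?_
  filter_upwards [self_mem_nhdsWithin] with ε hε using (Real.rpow_pos_of_pos hε α).ne'

theorem not_isTheta_of_orderOmega {f : ℝ → ℂ} {α : ℝ} (h : OrderOmega f α) :
    ¬ f =Θ[𝓝[>] (0 : ℝ)] fun ε => ε ^ α := by
  intro hT
  obtain ⟨c, hc⟩ := hT.isBigO.bound
  obtain ⟨ε, ⟨h1, h2⟩, h3⟩ := ((hc.and self_mem_nhdsWithin).and (h.eventually_gt_atTop c)).exists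
  have hpos : 0 < ε ^ α := Real.rpow_pos_of_pos h2 α
  rw [norm_mul, Complex.norm_real, Real.norm_of_nonneg (Real.rpow_nonneg (le_of_lt h2) _),
    Real.rpow_neg (le_of_lt h2), ← div_eq_mul_inv, lt_div_iff₀ hpos] at h3
  rw [Real.norm_of_nonneg hpos.le] at h1
  linarith

/-- The graphs `G` of the theorem define the same determinants as the critical graph. -/
theorem blockDet_criticalGraph_eq (hA : Irreducible A) (hk : 0 < numCrit A)
    (hU : IsPotential Finset.univ (hat A) 0 U) (a : Matrix (Fin n) (Fin n) ℂ) (C : Finset (Fin n))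
    (D : Fin n → ℂ) :
    blockDet (restrictGraph a (criticalGraph Finset.univ (hat A))) C D =
      blockDet (restrictGraph a (Tight Finset.univ (hat A) 0 U)) C D :=
  blockDet_restrictGraph_eq a (fun _ _ => criticalGraph_iff hU (rhoMin_hat hA hk)) C D

end Main

end MinPlus

/-! ### Assembly of the theorem -/

theorem mainTheorem6 (n : ℕ)
    (𝒜 : ℝ → Matrix (Fin n) (Fin n) ℂ)
    (a : Matrix (Fin n) (Fin n) ℂ)
    (A : Matrix (Fin n) (Fin n) (WithTop ℝ))
    (h𝒜 : ∀ i j, ClassC (fun ε => 𝒜 ε i j))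
    (hA : MinPlus.Irreducible A)
    (hlead : ∀ i j, HasLeading (fun ε => 𝒜 ε i j) (a i j) (A i j)) :
    -- the critical graph and the saturation graphs give the same data
    (∀ V, IsEigenvector (hat A) V → ∀ ℓ < numCrit A,
      (IsUnit (rMat A a (satGraph (hat A) V) ℓ) ↔
        IsUnit (rMat A a (criticalGraph Finset.univ (hat A)) ℓ)) ∧
      (IsUnit (rMat A a (criticalGraph Finset.univ (hat A)) ℓ) →
        nonzeroEigenvalues (tMat A a (satGraph (hat A) V) ℓ) =
          nonzeroEigenvalues (tMat A a (criticalGraph Finset.univ (hat A)) ℓ))) ∧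
    ∀ G : Fin n → Fin n → Prop,
      (G = criticalGraph Finset.univ (hat A) ∨
        ∃ V, IsEigenvector (hat A) V ∧ G = satGraph (hat A) V) →
      -- the three groups of eigenvalues
      (∀ ℓ < numCrit A, IsUnit (rMat A a G ℓ) →
        ∃ ev : Fin n → ℝ → ℂ, IsEigenvalueFamily 𝒜 ev ∧
          ∃ I₁ I₂ I₃ : Finset (Fin n),
            Disjoint I₁ I₂ ∧ Disjoint I₁ I₃ ∧ Disjoint I₂ I₃ ∧
            I₁ ∪ I₂ ∪ I₃ = Finset.univ ∧
            I₁.card = (nonzeroEigenvalues (tMat A a G ℓ)).card ∧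
            I₂.card = (nodesBefore A ℓ).card ∧
            I₃.card + (nonzeroEigenvalues (tMat A a G ℓ)).card = (nodesFrom A ℓ).card ∧
            (∃ lam : Fin n → ℂ, I₁.val.map lam = nonzeroEigenvalues (tMat A a G ℓ) ∧
              ∀ i ∈ I₁, Equiv0 (ev i) (lam i) (alpha A ℓ)) ∧
            (∀ i ∈ I₂, OrderOmega (ev i) (alpha A ℓ)) ∧
            (∀ i ∈ I₃, ev i =o[𝓝[>] (0 : ℝ)] fun ε => ε ^ alpha A ℓ)) ∧
      -- the case in which every `t` is invertible
      ((∀ ℓ < numCrit A, IsUnit (tMat A a G ℓ)) →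
        ∃ ev : Fin n → ℝ → ℂ, IsEigenvalueFamily 𝒜 ev ∧
          ∀ ℓ < numCrit A, ∃ I : Finset (Fin n),
            I.card = (critClass A ℓ).card ∧
            (∀ i, i ∈ I ↔ ev i =Θ[𝓝[>] (0 : ℝ)] fun ε => ε ^ alpha A ℓ) ∧
            ∃ lam : Fin n → ℂ, I.val.map lam = (tMat A a G ℓ).charpoly.roots ∧
              ∀ i ∈ I, Equiv0 (ev i) (lam i) (alpha A ℓ)) := by
  classical
  have hdets : ∀ G : Fin n → Fin n → Prop, 0 < numCrit A →
      (G = criticalGraph Finset.univ (hat A) ∨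
        ∃ V, IsEigenvector (hat A) V ∧ G = satGraph (hat A) V) →
      ∀ C D, blockDet (restrictGraph a G) C D =
        blockDet (restrictGraph a (criticalGraph Finset.univ (hat A))) C D := by
    rintro G hk (rfl | ⟨V, hV, rfl⟩) C D
    · rfl
    · obtain ⟨U, hU, hsat⟩ := hV.exists_potential hA hk
      rw [hsat, blockDet_criticalGraph_eq hA hk hU]
  -- One family is fixed before `ℓ` is chosen, so the same functions serve all critical values in
  -- the last statement.
  obtain ⟨ev, hev⟩ := exists_isEigenvalueFamily h𝒜
  refine ⟨fun V hV ℓ hℓ => ?_, fun G hG => ?_⟩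
  · have h := hdets _ (ℓ.zero_le.trans_lt hℓ) (Or.inr ⟨V, hV, rfl⟩)
    refine ⟨by rw [isUnit_rMat_iff, isUnit_rMat_iff, h], fun hr => ?_⟩
    rw [nonzeroEigenvalues, nonzeroEigenvalues, charpoly_tMat_eq (fun C D => (h C D).symm) hr]
  have hlimits : ∀ ℓ < numCrit A, IsUnit (rMat A a G ℓ) → ∃ (S : Finset (Fin n)) (l : Fin n → ℂ),
      (∀ i ∈ S, Tendsto (fun ε => ev i ε * ((ε ^ (-alpha A ℓ) : ℝ) : ℂ)) (𝓝[>] 0) (𝓝 (l i))) ∧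
      (∀ i ∉ S, OrderOmega (ev i) (alpha A ℓ)) ∧ S.card = (nodesFrom A ℓ).card ∧
      (S.filter fun i => l i ≠ 0).val.map l = nonzeroEigenvalues (tMat A a G ℓ) := by
    intro ℓ hℓ hr
    have hk := ℓ.zero_le.trans_lt hℓ
    obtain ⟨U, hU⟩ := exists_isPotential_hat hA hk
    exact exists_rescaled_limits hA hlead hℓ hU (fun C D => by
      rw [hdets G hk hG, blockDet_criticalGraph_eq hA hk hU]) hr hev
  refine ⟨fun ℓ hℓ hr => ⟨ev, hev, ?_⟩, fun ht => ⟨ev, hev, fun ℓ hℓ => ?_⟩⟩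
  · obtain ⟨S, l, hS, hS', hcard, hl⟩ := hlimits ℓ hℓ hr
    have hfilter := Finset.card_filter_add_card_filter_not (s := S) fun i => l i ≠ 0
    have hn := card_nodesFrom_add (A := A) ℓ
    have hcompl := Finset.card_add_card_compl S
    rw [Fintype.card_fin] at hcompl
    have hm : (S.filter fun i => l i ≠ 0).card = (nonzeroEigenvalues (tMat A a G ℓ)).card := by
      rw [← hl, Multiset.card_map]; rfl
    have hsub : ∀ T ⊆ S, Disjoint Sᶜ T := fun T hT => disjoint_compl_left.mono_right hT
    -- The groups are the indices whose rescaled eigenvalue has a nonzero limit, tends to infinity,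
    -- or tends to `0`. Their sizes follow from `S.card = (nodesFrom A ℓ).card`.
    refine ⟨S.filter fun i => l i ≠ 0, Sᶜ, S.filter fun i => ¬ l i ≠ 0,
      (hsub _ (Finset.filter_subset _ _)).symm, Finset.disjoint_filter_filter_not _ _ _,
      hsub _ (Finset.filter_subset _ _), ?_, hm, by omega, by omega,
      ⟨l, hl, fun i hi => ?_⟩, fun i hi => hS' i (Finset.mem_compl.1 hi), fun i hi => ?_⟩
    · rw [Finset.union_right_comm, Finset.filter_union_filter_not_eq, Finset.union_compl]
    · rw [Finset.mem_filter] at hi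
      exact equiv0_of_tendsto hi.2 (hS i hi.1)
    · rw [Finset.mem_filter, not_not] at hi
      exact isLittleO_of_rescaled_tendsto (hi.2 ▸ hS i hi.1)
  · obtain ⟨S, l, hS, hS', -, hl⟩ := hlimits ℓ hℓ (isUnit_rMat_of_isUnit_tMat ht ℓ hℓ)
    have hroots : nonzeroEigenvalues (tMat A a G ℓ) = (tMat A a G ℓ).charpoly.roots :=
      Multiset.filter_eq_self.2 fun z hz h0 => zero_notMem_roots_charpoly (ht ℓ hℓ) (h0 ▸ hz)
    rw [hroots] at hl
    have hequiv : ∀ i ∈ S.filter fun i => l i ≠ 0, Equiv0 (ev i) (l i) (alpha A ℓ) :=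
      fun i hi => equiv0_of_tendsto (Finset.mem_filter.1 hi).2 (hS i (Finset.mem_filter.1 hi).1)
    refine ⟨S.filter fun i => l i ≠ 0, ?_, fun i => ⟨fun hi =>
      isTheta_of_equiv0 (Finset.mem_filter.1 hi).2 (hequiv i hi), fun hT => ?_⟩, l, hl, hequiv⟩
    · rw [← Fintype.card_coe (critClass A ℓ), ← card_roots_charpoly (tMat A a G ℓ), ← hl,
        Multiset.card_map]
      rfl
    -- An index outside the group has rescaled limit `0` or infinity, and either excludes the exact
    -- order.
    · by_contra hi
      by_cases hiS : i ∈ S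
      · have h0 : l i = 0 := by
          by_contra h0
          exact hi (Finset.mem_filter.2 ⟨hiS, h0⟩)
        exact not_isTheta_of_isLittleO (isLittleO_of_rescaled_tendsto (h0 ▸ hS i hiS)) hT
      · exact not_isTheta_of_orderOmega (hS' i hiS) hT
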